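/- **Definitions.** A *Borel–Bratteli diagram* $B=(V,E)$ consists of at most countable vertex sets $V_n$ ($n\ge 0$), with $V_0=\{v_0\}$ a single point, at most countable edge sets $E_n$ ($n\ge 1$), and source and range maps $s:E_n\to V_{n-1}$, $r:E_n\to V_n$ such that $s^{-1}(v)\ne\emptyset$ for every vertex $v$, and $r^{-1}(v)$ is non-empty and finite for every $v\notin V_0$. Its path space $Y_B$ is the set of infinite paths $(e_1,e_2,\dots)$, $e_n\in E_n$, $s(e_{n+1})=r(e_n)$, with the topology generated by cylinder sets. $B$ is *ordered* if every $E_n$ carries a partial order in which two edges are comparable if and only if they have the same range, and no infinite path consists, from some level on, of maximal edges only or of minimal edges only. The *Vershik transformation* $\varphi:Y_B\to Y_B$ sends $(e_1,e_2,\dots)$ to $(f_1,\dots,f_{k-1},f_k,e_{k+1},\dots)$, where $k$ is least such that $e_k$ is not maximal, $f_k$ is the successor of $e_k$ in $r^{-1}(r(e_k))$, and $(f_1,\dots,f_{k-1})$ is the path of minimal edges from $v_0$ to $s(f_k)$. An ordered Borel–Bratteli diagram is *special* if, with the convention $V_{0,j}=\{v_0\}$ for all $j$, the following hold for all $n\ge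 1$. (i) $V_n$ is the disjoint union of sets $V_{n,j}$, $j\ge n$, with $2\le |V_{n,j}|<\infty$, and $V_{n,n}$ is the disjoint union of $V_{n,n}(0)$ and $V_{n,n}(1)$ with $|V_{n,n}(0)|\ge 2$. (ii) $E_n$ is the disjoint union of finite sets $E_{n,j}$, $j\ge n$. For $j>n$ one has $s(E_{n,j})=V_{n-1,j}$ and $r(E_{n,j})\subset V_{n,j}$. The set $E_{n,n}$ is the disjoint union of $E_{n,n}(0)$ and $E_{n,n}(1)$, where $V_{n-1,n-1}\subset s(E_{n,n}(0))\subset V_{n-1,n-1}\cup V_{n-1,n}$, $r(E_{n,n}(0))\subset V_{n,n}(0)$, $s(E_{n,n}(1))\subset V_{n-1,n}$, $r(E_{n,n}(1))\subset V_{n,n}(1)$ and $s(E_{n,n})=V_{n-1,n-1}\cup V_{n-1,n}$. Moreover $|r^{-1}(v)|=1$ if $v\in V_{n,j}$ with $j>n$ or $v\in V_{n,n}(1)$. If $v\in V_{n,n}(0)$, then $|r^{-1}(v)|\ge 4$, and the edges $e_1<\dots<e_m$ of $r^{-1}(v)$ satisfy $s(e_1)\in V_{n-1,n}$, $s(e_i)\in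 V_{n-1,n-1}$ for $1<i<m$, and $s(e_m)\in V_{n-1,n-1}(1)\cup\bigcup_{j>n-1}V_{n-1,j}$ (for $n=1$ the set $V_{0,0}(1)$ is to be ignored). Let $T$ be an aperiodic Borel automorphism of $X$. For $A\subset X$ and $k\ge 1$ let $C_k(A)$ be the set of $x\in A$ with $T^kx\in A$ and $T^ix\notin A$ for $0<i<k$. A *vanishing sequence of markers* for $T$ is a sequence of Borel sets $X=A_0\supset A_1\supset A_2\supset\cdots$ with $\bigcap_n A_n=\emptyset$ such that for every $n\ge1$: both $A_n$ and $X\setminus A_n$ meet every $T$-orbit; every $x\in A_n$ returns to $A_n$ under $T^m$ for infinitely many $m>0$ and for infinitely many $m<0$; $A_n\cap T^iA_n=\emptyset$ for $1\le i\le n-1$; and every non-empty $C_k(A_n)$, $k\ge1$, is uncountable. The set $A_n$ partitions $X$ into the $T$-towers $(T^iC_k(A_n))_{0\le i<k}$, $k\ge1$. **Theorem.** Let $X$ be a non-empty locally compact zero-dimensional Polish space (zero-dimensional: the clopen sets form a base) and let $T:X\to X$ be a homeomorphism without periodic points. Suppose that $T$ has a vanishing sequence of markers $(A_n)$ such that for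 all $n\ge1$ all the sets $T^iC_k(A_n)$, $0\le i<k$, of the associated tower partition are clopen. Then there exist a special (ordered) Borel–Bratteli diagram $B$, with Vershik transformation $\varphi$, and a homeomorphism $F:X\to Y_B$ such that $F\circ T=\varphi\circ F$. -/

import Mathlib

open Set Topology

/-! ### Borel–Bratteli diagrams -/

/-- A Borel–Bratteli diagram. `V n` is the set of vertices of level `n`, and `E n` is the set of
edges going from level `n` to level `n + 1` (usually written `E_{n+1}`). -/
structure BorelBratteli where
  V : ℕ → Type
  E : ℕ → Type
  s : ∀ n, E n → V n
  r : ∀ n, E n → V (n + 1)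
  v₀ : V 0
  eq_v₀ : ∀ v : V 0, v = v₀
  countable_V : ∀ n, Countable (V n)
  countable_E : ∀ n, Countable (E n)
  source_nonempty : ∀ n (v : V n), ∃ e, s n e = v
  range_nonempty : ∀ n (v : V (n + 1)), ∃ e, r n e = v
  range_finite : ∀ n (v : V (n + 1)), {e | r n e = v}.Finite

namespace BorelBratteli

/-- The space `Y_B` of infinite paths, which start at the top vertex. -/
def PathSpace (B : BorelBratteli) : Type :=
  {y : ∀ n, B.E n // ∀ n, B.s (n + 1) (y (n + 1)) = B.r n (y n)}

/-- The topology generated by the cylinder sets: the subspace topology inherited from the product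
of the discrete sets `E n`. -/
instance (B : BorelBratteli) : TopologicalSpace B.PathSpace :=
  TopologicalSpace.induced Subtype.val (@Pi.topologicalSpace ℕ B.E (fun _ => ⊥))

end BorelBratteli

/-- An ordered Borel–Bratteli diagram: each `E n` carries a partial order for which two edges are
comparable iff they have the same range, and no infinite path consists, from some level on, of
maximal edges only, or of minimal edges only. (As comparable edges have the same range, `IsMax e`
says that `e` is the largest element of the finite set `r⁻¹(r(e))`; same for `IsMin`.) -/
structure OrderedBorelBratteli extends BorelBratteli where
  order : ∀ n, PartialOrder (E n)
  comparable_iff : ∀ n (e f : E n), (e ≤ f ∨ f ≤ e) ↔ r n e = r n f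
  no_cofinal_max : ∀ y : toBorelBratteli.PathSpace, ¬ ∃ N, ∀ n, N ≤ n → IsMax (y.1 n)
  no_cofinal_min : ∀ y : toBorelBratteli.PathSpace, ¬ ∃ N, ∀ n, N ≤ n → IsMin (y.1 n)

namespace OrderedBorelBratteli

instance (B : OrderedBorelBratteli) (n : ℕ) : PartialOrder (B.E n) := B.order n

/-- `z` is the Vershik image of `y`: if `k` is the first level at which the edge of `y` is not
maximal, then `z` agrees with `y` after `k`, its edge at `k` is the successor of that of `y`, and
all its edges before `k` are minimal. -/
def IsVershikImage (B : OrderedBorelBratteli) (y z : B.PathSpace) : Prop :=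
  ∃ k, (∀ i, i < k → IsMax (y.1 i)) ∧ ¬ IsMax (y.1 k) ∧
    y.1 k ⋖ z.1 k ∧ (∀ i, k < i → z.1 i = y.1 i) ∧ (∀ i, i < k → IsMin (z.1 i))

theorem exists_min_edge (B : OrderedBorelBratteli) (n : ℕ) (v : B.V (n + 1)) :
    ∃ e : B.E n, B.r n e = v ∧ IsMin e := by
  obtain ⟨e, he⟩ := (B.range_finite n v).exists_minimal (B.range_nonempty n v)
  refine ⟨e, he.prop, fun f hf => he.le_of_le ?_ hf⟩
  exact ((B.comparable_iff n f e).1 (Or.inl hf)).trans he.prop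

theorem exists_succ_edge (B : OrderedBorelBratteli) (n : ℕ) (e : B.E n) (he : ¬ IsMax e) :
    ∃ f : B.E n, e ⋖ f := by
  obtain ⟨g, hg⟩ := not_isMax_iff.1 he
  have hfin : {f : B.E n | e < f}.Finite := (B.range_finite n (B.r n e)).subset
    fun f hf => ((B.comparable_iff n f e).1 (Or.inr (le_of_lt hf)))
  obtain ⟨f, hf⟩ := hfin.exists_minimal ⟨g, hg⟩
  exact ⟨f, hf.prop, fun c hec hcf => (not_le_of_gt hcf) (hf.le_of_le hec hcf.le)⟩

theorem exists_min_extension (B : OrderedBorelBratteli) (k : ℕ) :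
    ∀ y : ∀ n, B.E n, (∀ n, k ≤ n → B.s (n + 1) (y (n + 1)) = B.r n (y n)) →
      ∃ z : B.PathSpace, (∀ i, k ≤ i → z.1 i = y i) ∧ ∀ i, i < k → IsMin (z.1 i) := by
  induction k with
  | zero => exact fun y hy => ⟨⟨y, fun n => hy n (Nat.zero_le n)⟩, fun _ _ => rfl, by simp⟩
  | succ k ih =>
    intro y hy
    obtain ⟨g, hg, hmin⟩ := B.exists_min_edge k (B.s (k + 1) (y (k + 1)))
    obtain ⟨z, hz, hz'⟩ := ih (Function.update y k g) (by
      intro n hn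
      rw [Function.update_of_ne (by omega)]
      rcases hn.eq_or_lt with rfl | hn
      · simp [hg]
      · rw [Function.update_of_ne (by omega)]
        exact hy n hn)
    refine ⟨z, fun i hi => ?_, fun i hi => ?_⟩
    · rw [hz i (by omega), Function.update_of_ne (by omega)]
    · rcases (Nat.lt_succ_iff.1 hi).eq_or_lt with rfl | h
      · rw [hz i le_rfl, Function.update_self]
        exact hmin
      · exact hz' i h

theorem exists_isVershikImage (B : OrderedBorelBratteli) (y : B.PathSpace) :
    ∃ z, B.IsVershikImage y z := by
  classical
  have hex : ∃ k, ¬ IsMax (y.1 k) := by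
    by_contra h
    push Not at h
    exact B.no_cofinal_max y ⟨0, fun n _ => h n⟩
  set k := Nat.find hex with hk
  have hkm : ¬ IsMax (y.1 k) := Nat.find_spec hex
  obtain ⟨f, hf⟩ := B.exists_succ_edge k (y.1 k) hkm
  obtain ⟨z, hz, hz'⟩ := B.exists_min_extension k (Function.update y.1 k f) (by
    intro n hn
    rw [Function.update_of_ne (by omega), y.2 n]
    rcases hn.eq_or_lt with h | hn
    · rw [← h, Function.update_self]
      exact (B.comparable_iff k _ _).1 (Or.inl hf.le)
    · rw [Function.update_of_ne (by omega)])
  refine ⟨z, k, fun i hi => not_not.1 (Nat.find_min hex hi), hkm, ?_, fun i hi => ?_, hz'⟩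
  · rw [hz k le_rfl, Function.update_self]
    exact hf
  · rw [hz i hi.le, Function.update_of_ne (by omega)]

theorem IsVershikImage.unique (B : OrderedBorelBratteli) {y z z' : B.PathSpace}
    (h : B.IsVershikImage y z) (h' : B.IsVershikImage y z') : z = z' := by
  obtain ⟨k, h1, h2, h3, h4, h5⟩ := h
  obtain ⟨l, g1, g2, g3, g4, g5⟩ := h'
  obtain rfl : k = l := by
    rcases lt_trichotomy k l with hlt | heq | hlt
    · exact absurd (g1 k hlt) h2
    · exact heq
    · exact absurd (h1 l hlt) g2
  have hk : z.1 k = z'.1 k := by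
    have hr : B.r k (z.1 k) = B.r k (z'.1 k) :=
      ((B.comparable_iff k _ _).1 (Or.inr h3.le)).trans ((B.comparable_iff k _ _).1 (Or.inl g3.le))
    rcases (B.comparable_iff k _ _).2 hr with h | h
    · exact h.eq_or_lt.resolve_right (g3.2 h3.1)
    · exact (h.eq_or_lt.resolve_right (h3.2 g3.1)).symm
  have hlow : ∀ d i, i + d = k → z.1 i = z'.1 i := by
    intro d
    induction d with
    | zero => rintro i rfl; exact hk
    | succ d ih =>
      intro i hi
      have hr : B.r i (z.1 i) = B.r i (z'.1 i) := by
        rw [← z.2 i, ← z'.2 i, ih (i + 1) (by omega)]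
      rcases (B.comparable_iff i _ _).2 hr with h | h
      · exact le_antisymm h (g5 i (by omega) h)
      · exact le_antisymm (h5 i (by omega) h) h
  refine Subtype.ext (funext fun i => ?_)
  rcases le_or_gt i k with hi | hi
  · exact hlow (k - i) i (by omega)
  · rw [h4 i hi, g4 i hi]

/-- The Vershik transformation of the path space of an ordered Borel–Bratteli diagram. -/
noncomputable def vershik (B : OrderedBorelBratteli) (y : B.PathSpace) : B.PathSpace :=
  Classical.choose (B.exists_isVershikImage y)

theorem isVershikImage_vershik (B : OrderedBorelBratteli) (y : B.PathSpace) :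
    B.IsVershikImage y (B.vershik y) :=
  Classical.choose_spec (B.exists_isVershikImage y)

/-! ### Special Borel–Bratteli diagrams -/

/-- The data exhibiting an ordered Borel–Bratteli diagram as a special one.

* `VC n j`, for `j ≥ n`, is the set `V_{nj}`; on level `0` all of them are `{v₀}`.
* `VC0 n` and `VC1 n`, for `n ≥ 1`, are the sets `V_{nn}(0)` and `V_{nn}(1)`.
* `EC n j`, for `j ≥ n + 1`, is the set `E_{n+1,j}` of edges from level `n` to level `n + 1`.
* `EC0 n` and `EC1 n` are the sets `E_{n+1,n+1}(0)` and `E_{n+1,n+1}(1)`. -/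
structure SpecialStructure (B : OrderedBorelBratteli) where
  VC : ∀ n, ℕ → Set (B.V n)
  VC0 : ∀ n, Set (B.V n)
  VC1 : ∀ n, Set (B.V n)
  EC : ∀ n, ℕ → Set (B.E n)
  EC0 : ∀ n, Set (B.E n)
  EC1 : ∀ n, Set (B.E n)
  VC_zero : ∀ j, VC 0 j = {B.v₀}
  -- the partition of the vertices
  VC_cover : ∀ n, 1 ≤ n → ∀ v : B.V n, ∃ j, n ≤ j ∧ v ∈ VC n j
  VC_disjoint : ∀ n, 1 ≤ n → ∀ j j', n ≤ j → n ≤ j' → j ≠ j' → Disjoint (VC n j) (VC n j')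
  VC_finite : ∀ n, 1 ≤ n → ∀ j, n ≤ j → (VC n j).Finite
  VC_two_le : ∀ n, 1 ≤ n → ∀ j, n ≤ j → 2 ≤ (VC n j).ncard
  VC_diag : ∀ n, 1 ≤ n → VC n n = VC0 n ∪ VC1 n
  VC_diag_disjoint : ∀ n, 1 ≤ n → Disjoint (VC0 n) (VC1 n)
  VC0_two_le : ∀ n, 1 ≤ n → 2 ≤ (VC0 n).ncard
  -- the partition of the edges
  EC_cover : ∀ n (e : B.E n), ∃ j, n + 1 ≤ j ∧ e ∈ EC n j
  EC_disjoint : ∀ n j j', n + 1 ≤ j → n + 1 ≤ j' → j ≠ j' → Disjoint (EC n j) (EC n j')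
  EC_finite : ∀ n j, n + 1 ≤ j → (EC n j).Finite
  EC_source : ∀ n j, n + 1 < j → B.s n '' EC n j = VC n j
  EC_range : ∀ n j, n + 1 < j → ∀ e ∈ EC n j, B.r n e ∈ VC (n + 1) j
  EC_diag : ∀ n, EC n (n + 1) = EC0 n ∪ EC1 n
  EC_diag_disjoint : ∀ n, Disjoint (EC0 n) (EC1 n)
  EC_diag_source : ∀ n, B.s n '' EC n (n + 1) = VC n n ∪ VC n (n + 1)
  EC0_source : ∀ n, ∀ e ∈ EC0 n, B.s n e ∈ VC n n ∪ VC n (n + 1)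
  subset_EC0_source : ∀ n, VC n n ⊆ B.s n '' EC0 n
  EC0_range : ∀ n, ∀ e ∈ EC0 n, B.r n e ∈ VC0 (n + 1)
  EC1_source : ∀ n, ∀ e ∈ EC1 n, B.s n e ∈ VC n (n + 1)
  EC1_range : ∀ n, ∀ e ∈ EC1 n, B.r n e ∈ VC1 (n + 1)
  -- the number of edges arriving at a vertex
  card_range : ∀ n j, n + 1 < j → ∀ v ∈ VC (n + 1) j, {e | B.r n e = v}.ncard = 1
  card_range_one : ∀ n, ∀ v ∈ VC1 (n + 1), {e | B.r n e = v}.ncard = 1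
  card_range_zero : ∀ n, ∀ v ∈ VC0 (n + 1), 4 ≤ {e | B.r n e = v}.ncard
  -- the order `e₁ < ⋯ < eₘ` on the edges arriving at a vertex of `V_{n+1,n+1}(0)`
  source_min : ∀ n (e : B.E n), B.r n e ∈ VC0 (n + 1) → IsMin e → B.s n e ∈ VC n (n + 1)
  source_mid : ∀ n (e : B.E n), B.r n e ∈ VC0 (n + 1) → ¬ IsMin e → ¬ IsMax e →
    B.s n e ∈ VC n n
  source_max : ∀ n (e : B.E n), B.r n e ∈ VC0 (n + 1) → IsMax e →
    B.s n e ∈ VC1 n ∨ ∃ j, n < j ∧ B.s n e ∈ VC n j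

/-- An ordered Borel–Bratteli diagram is special if it admits a special structure. -/
def IsSpecial (B : OrderedBorelBratteli) : Prop := Nonempty B.SpecialStructure

end OrderedBorelBratteli

/-! ### Aperiodic homeomorphisms and vanishing sequences of markers -/

section Markers

variable {X : Type*} [TopologicalSpace X]

/-- `T` has no periodic points. -/
def IsAperiodic (T : X ≃ₜ X) : Prop := ∀ x, ∀ n : ℕ, 0 < n → (T ^ n) x ≠ x

/-- Every `T`-orbit meets `A`. -/
def IsCompleteSection (T : X ≃ₜ X) (A : Set X) : Prop := ∀ x, ∃ k : ℤ, (T ^ k) x ∈ A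

/-- The set `C_k` of points of `A` whose first return time to `A` is `k` (for `k ≥ 1`). -/
def towerBase (T : X ≃ₜ X) (A : Set X) (k : ℕ) : Set X :=
  {x | x ∈ A ∧ (T ^ k) x ∈ A ∧ ∀ i : ℕ, 0 < i → i < k → (T ^ i) x ∉ A}

/-- Vanishing sequences of markers. -/
structure IsVanishingMarkers [MeasurableSpace X] (T : X ≃ₜ X) (A : ℕ → Set X) : Prop where
  measurable : ∀ n, MeasurableSet (A n)
  zero : A 0 = univ
  antitone : ∀ n, A (n + 1) ⊆ A n
  inter : ⋂ n, A n = ∅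
  section_self : ∀ n, 1 ≤ n → IsCompleteSection T (A n)
  section_compl : ∀ n, 1 ≤ n → IsCompleteSection T (A n)ᶜ
  recurrent_pos : ∀ n, 1 ≤ n → ∀ x ∈ A n, {m : ℕ | (T ^ m) x ∈ A n}.Infinite
  recurrent_neg : ∀ n, 1 ≤ n → ∀ x ∈ A n, {m : ℕ | (T⁻¹ ^ m) x ∈ A n}.Infinite
  separated : ∀ n, 1 ≤ n → ∀ i, 1 ≤ i → i < n → A n ∩ (T ^ i) '' A n = ∅
  uncountable : ∀ n, 1 ≤ n → ∀ k, 1 ≤ k → (towerBase T (A n) k).Nonempty →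
    ¬ (towerBase T (A n) k).Countable

/-- For each `n ≥ 1`, all atoms `T^i C_k`, `0 ≤ i < k`, of the partition of `X` into the `T`-towers
built over the marker set `A n` are clopen. -/
def HasClopenTowers (T : X ≃ₜ X) (A : ℕ → Set X) : Prop :=
  ∀ n, 1 ≤ n → ∀ k i : ℕ, i < k → IsClopen ((T ^ i) '' towerBase T (A n) k)

end Markers

/-! The given markers are replaced by the sets `{x | n ≤ lev x}`, the complements of an increasing
sequence of compact open sets. The towers over these sets have height one except near a compact set,
so there are only finitely many labels over each compact open set `{x | lev x = j}`. This finiteness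
is what a special diagram demands.

The markers `A n` are closed and decrease to the empty set, so a compact set misses one of them
(`exists_disjoint`). Since every orbit visits each `A n` infinitely often in both directions of
time, every orbit leaves every compact set in both directions. An exhaustion `compactExhaustion` is
then built so that `lev` drops by at most one along `T`, and rises by at most one, each rise coming
after three consecutive points of equal level. Entrances into a compact set are infinite in number
(`infinite_setOf_map_mem`), so a clopen set can separate two of them at each level. The result is a
`LevelFunction`.

For a level function, each tower over `{x | n ≤ lev x}` is labelled by the word of levels and
memberships in the first `n` sets `U i` read along it. Labels are the vertices. An edge is a
position in a tower of level `n + 1` at which a tower of level `n` begins, ordered by height. The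
first `n` edges of a point amount to its tower of level `n` and its height there
(`forall_edge_eq_iff`). Hence `path` is injective and inducing because the `U i` form a base, and
surjective because cylinders are compact. Applying `T` moves one step up the towers, which is the
Vershik move at level `lev (T x)`. The control on drops and rises of `lev` supplies the special
structure (`lev_last`). -/

section LevelFunctions

variable {X : Type*} [TopologicalSpace X]

/-- An exhaustion of `X` by the compact open sets `{x | lev x < n}`, adapted to the dynamics of
`T`, together with a countable base `U` of clopen sets. -/
structure LevelFunction (T : X ≃ₜ X) where
  lev : X → ℕ
  U : ℕ → Set X
  isLocallyConstant_lev : IsLocallyConstant lev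
  isCompact_lev : ∀ n, IsCompact {x | lev x < n}
  lev_le : ∀ x, lev x ≤ lev (T x) + 1
  -- The run of three equal levels before a rise provides, together with the base, the four edges
  -- required at a vertex with a tall tower.
  lev_eq_of_lt : ∀ x, lev x < lev (T x) →
    lev (T x) = lev x + 1 ∧ lev (T.symm x) = lev x ∧ lev (T.symm (T.symm x)) = lev x
  forward : ∀ n x, ∃ i, 0 < i ∧ n ≤ lev (T^[i] x)
  backward : ∀ n x, ∃ i, n ≤ lev (T.symm^[i] x)
  isClopen_U : ∀ i, IsClopen (U i)
  -- One set `U 0` serves all levels, because it enters the labels from level one on. It ensures at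
  -- least two tall towers at every level.
  exists_split : ∀ n, 1 ≤ n → ∃ x y, n ≤ lev x ∧ lev (T x) < n ∧ n ≤ lev y ∧ lev (T y) < n ∧
    x ∈ U 0 ∧ y ∉ U 0
  exists_subset : ∀ x O, IsOpen O → x ∈ O → ∃ i, x ∈ U i ∧ U i ⊆ O

theorem Homeomorph.symm_iterate_iterate (T : X ≃ₜ X) {m k : ℕ} (h : m ≤ k) (x : X) :
    T.symm^[m] (T^[k] x) = T^[k - m] x := by
  obtain ⟨d, rfl⟩ := Nat.exists_eq_add_of_le h
  rw [Function.iterate_add_apply, Nat.add_sub_cancel_left]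
  exact (Function.LeftInverse.iterate T.symm_apply_apply m) _

theorem Homeomorph.iterate_symm_iterate (T : X ≃ₜ X) {m k : ℕ} (h : m ≤ k) (x : X) :
    T^[m] (T.symm^[k] x) = T.symm^[k - m] x := by
  obtain ⟨d, rfl⟩ := Nat.exists_eq_add_of_le h
  rw [Function.iterate_add_apply, Nat.add_sub_cancel_left]
  exact (Function.LeftInverse.iterate T.apply_symm_apply m) _

/-! ### Towers over the sets `{x | n ≤ lev x}` and their labels -/

namespace LevelFunction

variable {T : X ≃ₜ X} (L : LevelFunction T)

open Classical in
/-- The time elapsed since the last visit to `{x | n ≤ lev x}`. -/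
noncomputable def back (n : ℕ) (x : X) : ℕ := Nat.find (L.backward n x)

/-- The last point of the backward orbit lying in `{x | n ≤ lev x}`. -/
noncomputable def base (n : ℕ) (x : X) : X := T.symm^[L.back n x] x

open Classical in
/-- The first return time to `{x | n ≤ lev x}`. -/
noncomputable def ret (n : ℕ) (x : X) : ℕ := Nat.find (L.forward n x)

open Classical in
/-- The label of a point at level `n`. -/
noncomputable def code (n : ℕ) (x : X) : ℕ × Finset ℕ :=
  -- The constant label at level `0` leaves a single top vertex. From level one on, recording `lev`
  -- lets a word determine the subdivision of its tower into towers of lower level.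
  if n = 0 then (0, ∅) else (L.lev x, (Finset.range n).filter fun i => x ∈ L.U i)

/-- The labels read along the orbit until the first return to `{x | n ≤ lev x}`. -/
noncomputable def word (n : ℕ) (x : X) : List (ℕ × Finset ℕ) :=
  (List.range (L.ret n x)).map fun i => L.code n (T^[i] x)

/-- The label of the tower of level `n` containing a point. -/
noncomputable def vtx (n : ℕ) (x : X) : List (ℕ × Finset ℕ) := L.word n (L.base n x)

theorem le_lev_base (n : ℕ) (x : X) : n ≤ L.lev (L.base n x) := by
  classical
  exact Nat.find_spec (L.backward n x)

theorem iterate_base (n : ℕ) (x : X) : T^[L.back n x] (L.base n x) = x := by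
  simp [base, T.iterate_symm_iterate le_rfl]

theorem lev_iterate_base_lt {n i : ℕ} {x : X} (hi : 0 < i) (hib : i ≤ L.back n x) :
    L.lev (T^[i] (L.base n x)) < n := by
  classical
  rw [base, T.iterate_symm_iterate hib]
  exact not_le.1 (Nat.find_min (L.backward n x) (m := L.back n x - i) (show _ < L.back n x by omega))

theorem back_iterate {n k : ℕ} {x : X} (hx : n ≤ L.lev x)
    (hk : ∀ i, 0 < i → i ≤ k → L.lev (T^[i] x) < n) : L.back n (T^[k] x) = k := by
  classical
  rw [back, Nat.find_eq_iff]
  refine ⟨by simpa [T.symm_iterate_iterate le_rfl] using hx, fun m hm => ?_⟩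
  rw [T.symm_iterate_iterate hm.le, not_le]
  exact hk _ (by omega) (by omega)

theorem base_iterate {n k : ℕ} {x : X} (hx : n ≤ L.lev x)
    (hk : ∀ i, 0 < i → i ≤ k → L.lev (T^[i] x) < n) : L.base n (T^[k] x) = x := by
  rw [base, L.back_iterate hx hk, T.symm_iterate_iterate le_rfl]
  simp

theorem back_eq_zero {n : ℕ} {x : X} (hx : n ≤ L.lev x) : L.back n x = 0 :=
  L.back_iterate (k := 0) hx fun _ _ _ => by omega

theorem base_eq_self {n : ℕ} {x : X} (hx : n ≤ L.lev x) : L.base n x = x :=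
  L.base_iterate (k := 0) hx fun _ _ _ => by omega

theorem back_eq_zero_iff {n : ℕ} {x : X} : L.back n x = 0 ↔ n ≤ L.lev x := by
  refine ⟨fun h => ?_, L.back_eq_zero⟩
  have := L.le_lev_base n x
  rwa [base, h] at this

theorem vtx_eq_word {n : ℕ} {x : X} (hx : n ≤ L.lev x) : L.vtx n x = L.word n x := by
  rw [vtx, L.base_eq_self hx]

theorem vtx_base (n : ℕ) (x : X) : L.vtx n (L.base n x) = L.vtx n x :=
  L.vtx_eq_word (L.le_lev_base n x)

theorem ret_pos (n : ℕ) (x : X) : 0 < L.ret n x := by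
  classical
  exact (Nat.find_spec (L.forward n x)).1

theorem le_lev_iterate_ret (n : ℕ) (x : X) : n ≤ L.lev (T^[L.ret n x] x) := by
  classical
  exact (Nat.find_spec (L.forward n x)).2

theorem lev_iterate_lt_of_lt_ret {n i : ℕ} {x : X} (hi : 0 < i) (hir : i < L.ret n x) :
    L.lev (T^[i] x) < n := by
  classical
  have := Nat.find_min (L.forward n x) hir
  grind

theorem ret_eq {n k : ℕ} {x : X} (hk : 0 < k) (hkx : n ≤ L.lev (T^[k] x))
    (h : ∀ i, 0 < i → i < k → L.lev (T^[i] x) < n) : L.ret n x = k := by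
  classical
  rw [ret, Nat.find_eq_iff]
  exact ⟨⟨hk, hkx⟩, fun m hm ⟨h1, h2⟩ => absurd (h m h1 hm) (by omega)⟩

theorem back_lt_ret (n : ℕ) (x : X) : L.back n x < L.ret n (L.base n x) := by
  by_contra! h
  have h1 := L.lev_iterate_base_lt (L.ret_pos n _) h
  have h2 := L.le_lev_iterate_ret n (L.base n x)
  omega

theorem back_iterate_of_lt {n k : ℕ} {x : X} (hx : n ≤ L.lev x) (hk : k < L.ret n x) :
    L.back n (T^[k] x) = k :=
  L.back_iterate hx fun _ h1 h2 => L.lev_iterate_lt_of_lt_ret h1 (by omega)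

theorem base_iterate_of_lt {n k : ℕ} {x : X} (hx : n ≤ L.lev x) (hk : k < L.ret n x) :
    L.base n (T^[k] x) = x :=
  L.base_iterate hx fun _ h1 h2 => L.lev_iterate_lt_of_lt_ret h1 (by omega)

theorem back_map {n : ℕ} {x : X} (hx : L.lev (T x) < n) : L.back n (T x) = L.back n x + 1 := by
  have h := L.iterate_base n x
  have h' : T x = T^[L.back n x + 1] (L.base n x) := by rw [Function.iterate_succ_apply', h]
  rw [h']
  refine L.back_iterate (L.le_lev_base n x) fun i h1 h2 => ?_
  rcases h2.lt_or_eq with h2 | rfl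
  · exact L.lev_iterate_base_lt h1 (by omega)
  · rwa [Function.iterate_succ_apply', h]

theorem base_map {n : ℕ} {x : X} (hx : L.lev (T x) < n) : L.base n (T x) = L.base n x := by
  rw [base, L.back_map hx, Function.iterate_succ_apply, T.symm_apply_apply, base]

theorem ret_eq_one_iff {n : ℕ} {x : X} : L.ret n x = 1 ↔ n ≤ L.lev (T x) := by
  constructor
  · intro h
    simpa [h] using L.le_lev_iterate_ret n x
  · exact fun h => L.ret_eq one_pos (by simpa using h) (by intros; omega)

@[simp]
theorem length_word (n : ℕ) (x : X) : (L.word n x).length = L.ret n x := by simp [word]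

theorem word_eq_iff {n : ℕ} {x y : X} : L.word n x = L.word n y ↔
    L.ret n x = L.ret n y ∧ ∀ i < L.ret n x, L.code n (T^[i] x) = L.code n (T^[i] y) := by
  constructor
  · intro h
    have hl : L.ret n x = L.ret n y := by simpa using congrArg List.length h
    refine ⟨hl, ?_⟩
    rw [word, word, hl] at h
    rw [hl]
    simpa using h
  · rintro ⟨h1, h2⟩
    rw [h1] at h2
    rw [word, word, h1]
    simpa using h2

theorem code_zero (x y : X) : L.code 0 x = L.code 0 y := by simp [code]

theorem code_eq_iff {n : ℕ} (hn : 1 ≤ n) {x y : X} : L.code n x = L.code n y ↔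
    L.lev x = L.lev y ∧ ∀ i < n, x ∈ L.U i ↔ y ∈ L.U i := by
  rw [code, code, if_neg (by omega), if_neg (by omega), Prod.mk.injEq, Finset.ext_iff]
  simp

theorem code_of_succ {n : ℕ} {x y : X} (h : L.code (n + 1) x = L.code (n + 1) y) :
    L.code n x = L.code n y := by
  rcases n.eq_zero_or_pos with rfl | hn
  · exact L.code_zero x y
  · rw [L.code_eq_iff (by omega)] at h ⊢
    exact ⟨h.1, fun i hi => h.2 i (by omega)⟩

theorem lev_eq_of_code {n : ℕ} (hn : 1 ≤ n) {x y : X} (h : L.code n x = L.code n y) :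
    L.lev x = L.lev y := ((L.code_eq_iff hn).1 h).1

theorem lev_eq_of_word {n : ℕ} (hn : 1 ≤ n) {x y : X} (h : L.word n x = L.word n y) :
    L.lev x = L.lev y :=
  L.lev_eq_of_code hn ((L.word_eq_iff.1 h).2 0 (L.ret_pos n x))

theorem code_eq_of_vtx {n : ℕ} {x y : X} (h : L.vtx n x = L.vtx n y)
    (hb : L.back n x = L.back n y) : L.code n x = L.code n y := by
  have := (L.word_eq_iff.1 h).2 _ (L.back_lt_ret n x)
  rwa [L.iterate_base, hb, L.iterate_base] at this

theorem vtx_zero (x y : X) : L.vtx 0 x = L.vtx 0 y := by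
  rw [vtx, vtx, word_eq_iff]
  refine ⟨?_, fun _ _ => L.code_zero _ _⟩
  rw [L.ret_eq_one_iff.2 (Nat.zero_le _), L.ret_eq_one_iff.2 (Nat.zero_le _)]

/-! ### Towers of level `n` inside towers of level `n + 1` -/

theorem ret_le_ret_iterate {n k : ℕ} {x : X} (hk : k < L.ret (n + 1) x) :
    k + L.ret n (T^[k] x) ≤ L.ret (n + 1) x := by
  by_contra! h
  have h1 := L.lev_iterate_lt_of_lt_ret (n := n) (x := T^[k] x) (i := L.ret (n + 1) x - k)
    (by omega) (by omega)
  rw [← Function.iterate_add_apply, Nat.sub_add_cancel hk.le] at h1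
  have := L.le_lev_iterate_ret (n + 1) x
  omega

/-- The word of level `n + 1` lists the levels of all points of the tower, so it shows the returns
to `{x | n ≤ lev x}` inside it. A return at the very end of the tower is not listed, but there both
orbits are back at level at least `n + 1`. -/
theorem word_iterate_eq {n k : ℕ} {x y : X} (h : L.word (n + 1) x = L.word (n + 1) y)
    (hk : k < L.ret (n + 1) x) : L.word n (T^[k] x) = L.word n (T^[k] y) := by
  obtain ⟨hr, hc⟩ := L.word_eq_iff.1 h
  have hlev : ∀ i, i < L.ret (n + 1) x → L.lev (T^[i] x) = L.lev (T^[i] y) := fun i hi =>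
    L.lev_eq_of_code (by omega) (hc i hi)
  have hle := L.ret_le_ret_iterate hk
  have hret : L.ret n (T^[k] y) = L.ret n (T^[k] x) := by
    refine L.ret_eq (L.ret_pos _ _) ?_ fun i h1 h2 => ?_
    · have := L.le_lev_iterate_ret n (T^[k] x)
      rw [← Function.iterate_add_apply, add_comm] at this ⊢
      rcases hle.lt_or_eq with hlt | heq
      · rwa [← hlev _ hlt]
      · rw [heq, hr]
        exact (Nat.le_succ n).trans (L.le_lev_iterate_ret (n + 1) y)
    · have := L.lev_iterate_lt_of_lt_ret h1 h2
      rw [← Function.iterate_add_apply] at this ⊢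
      rwa [← hlev _ (by omega)]
  refine L.word_eq_iff.2 ⟨hret.symm, fun i hi => ?_⟩
  rw [← Function.iterate_add_apply, ← Function.iterate_add_apply]
  exact L.code_of_succ (hc _ (by omega))

theorem back_le_succ (n : ℕ) (x : X) : L.back n x ≤ L.back (n + 1) x := by
  by_contra! h
  have h1 := L.lev_iterate_base_lt (n := n) (x := x) (i := L.back n x - L.back (n + 1) x)
    (by omega) (by omega)
  rw [base, T.iterate_symm_iterate (by omega), Nat.sub_sub_self h.le] at h1
  have := L.le_lev_base (n + 1) x
  rw [base] at this
  omega

theorem base_eq_iterate (n : ℕ) (x : X) :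
    L.base n x = T^[L.back (n + 1) x - L.back n x] (L.base (n + 1) x) := by
  rw [base, base, T.iterate_symm_iterate (by omega), Nat.sub_sub_self (L.back_le_succ n x)]

theorem back_succ_base (n : ℕ) (x : X) :
    L.back (n + 1) (L.base n x) = L.back (n + 1) x - L.back n x := by
  rw [base_eq_iterate]
  exact L.back_iterate_of_lt (L.le_lev_base _ x)
    (lt_of_le_of_lt (Nat.sub_le _ _) (L.back_lt_ret _ x))

theorem base_succ_base (n : ℕ) (x : X) : L.base (n + 1) (L.base n x) = L.base (n + 1) x := by
  rw [L.base_eq_iterate n x]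
  exact L.base_iterate_of_lt (L.le_lev_base _ x)
    (lt_of_le_of_lt (Nat.sub_le _ _) (L.back_lt_ret _ x))

theorem vtx_succ_base (n : ℕ) (x : X) : L.vtx (n + 1) (L.base n x) = L.vtx (n + 1) x := by
  rw [vtx, base_succ_base, vtx]

/-- The tower of level `n + 1` and the height in it determine those of level `n`. -/
theorem atom_of_succ {n : ℕ} {x y : X} (hv : L.vtx (n + 1) x = L.vtx (n + 1) y)
    (hb : L.back (n + 1) x = L.back (n + 1) y) :
    L.vtx n x = L.vtx n y ∧ L.back n x = L.back n y := by
  obtain ⟨-, hc⟩ := L.word_eq_iff.1 hv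
  have hlt := L.back_lt_ret (n + 1) x
  have hlev : ∀ i, i ≤ L.back (n + 1) x →
      L.lev (T^[i] (L.base (n + 1) x)) = L.lev (T^[i] (L.base (n + 1) y)) := fun i hi =>
    L.lev_eq_of_code (by omega) (hc i (by omega))
  have hle := L.back_le_succ n x
  set w := T^[L.back (n + 1) x - L.back n x] (L.base (n + 1) y) with hw
  have hwl : n ≤ L.lev w := by
    rw [hw, ← hlev _ (by omega), ← base_eq_iterate]
    exact L.le_lev_base n x
  have hwi : ∀ i, 0 < i → i ≤ L.back n x → L.lev (T^[i] w) < n := by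
    intro i h1 h2
    have := L.lev_iterate_base_lt h1 h2
    rw [base_eq_iterate, ← Function.iterate_add_apply, hlev _ (by omega)] at this
    rwa [hw, ← Function.iterate_add_apply]
  have hy : T^[L.back n x] w = y := by
    rw [hw, ← Function.iterate_add_apply, Nat.add_sub_cancel' hle, hb, iterate_base]
  have h1 := L.back_iterate hwl hwi
  have h2 := L.base_iterate hwl hwi
  rw [hy] at h1 h2
  refine ⟨?_, h1.symm⟩
  rw [vtx, vtx, h2, hw, base_eq_iterate]
  exact L.word_iterate_eq hv (by omega)

end LevelFunction

namespace LevelFunction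

variable {T : X ≃ₜ X} (L : LevelFunction T)

/-! ### Local constancy -/

theorem isLocallyConstant_code (n : ℕ) : IsLocallyConstant (L.code n) := by
  rw [IsLocallyConstant.iff_eventually_eq]
  intro x
  rcases n.eq_zero_or_pos with rfl | hn
  · exact Filter.Eventually.of_forall fun y => L.code_zero y x
  have h1 : ∀ᶠ y in 𝓝 x, L.lev y = L.lev x :=
    (IsLocallyConstant.iff_eventually_eq _).1 L.isLocallyConstant_lev x
  have h2 : ∀ᶠ y in 𝓝 x, ∀ i ∈ Finset.range n, (y ∈ L.U i ↔ x ∈ L.U i) := by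
    rw [Filter.eventually_all_finset]
    intro i _
    by_cases hx : x ∈ L.U i
    · filter_upwards [(L.isClopen_U i).isOpen.mem_nhds hx] with y hy
      simp [hx, hy]
    · filter_upwards [(L.isClopen_U i).compl.isOpen.mem_nhds hx] with y hy
      simpa [hx] using hy
  filter_upwards [h1, h2] with y hy1 hy2
  exact (L.code_eq_iff hn).2 ⟨hy1, fun i hi => hy2 i (Finset.mem_range.2 hi)⟩

/-- Label and height depend only on `lev` and `code n` along the finite orbit segment from the base
of the tower to the next return, and each of these finitely many conditions is locally constant. -/
theorem isLocallyConstant_atom (n : ℕ) :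
    IsLocallyConstant fun x => (L.vtx n x, L.back n x) := by
  rw [IsLocallyConstant.iff_eventually_eq]
  intro x
  have hcont : ∀ j, Continuous fun y => T^[j] (T.symm^[L.back n x] y) := fun j =>
    (T.continuous.iterate j).comp (T.symm.continuous.iterate _)
  have hev : ∀ᶠ y in 𝓝 x, ∀ j ∈ Finset.range (L.ret n (L.base n x) + 1),
      L.lev (T^[j] (T.symm^[L.back n x] y)) = L.lev (T^[j] (L.base n x)) ∧
      L.code n (T^[j] (T.symm^[L.back n x] y)) = L.code n (T^[j] (L.base n x)) := by
    rw [Filter.eventually_all_finset]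
    intro j _
    exact ((IsLocallyConstant.iff_eventually_eq _).1
      (L.isLocallyConstant_lev.comp_continuous (hcont j)) x).and
      ((IsLocallyConstant.iff_eventually_eq _).1
      ((L.isLocallyConstant_code n).comp_continuous (hcont j)) x)
  filter_upwards [hev] with y hy
  set w := T.symm^[L.back n x] y with hw
  have hlev : ∀ j, j ≤ L.ret n (L.base n x) → L.lev (T^[j] w) = L.lev (T^[j] (L.base n x)) :=
    fun j hj => (hy j (Finset.mem_range.2 (by omega))).1
  have hwl : n ≤ L.lev w := by
    have := hlev 0 (Nat.zero_le _)
    rw [Function.iterate_zero, id, id] at this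
    rw [this]
    exact L.le_lev_base n x
  have hlt := L.back_lt_ret n x
  have hwi : ∀ i, 0 < i → i ≤ L.back n x → L.lev (T^[i] w) < n := fun i h1 h2 => by
    rw [hlev _ (by omega)]
    exact L.lev_iterate_base_lt h1 h2
  have hyw : T^[L.back n x] w = y := by simp [hw, T.iterate_symm_iterate le_rfl]
  have h1 := L.back_iterate hwl hwi
  have h2 := L.base_iterate hwl hwi
  rw [hyw] at h1 h2
  have hret : L.ret n w = L.ret n (L.base n x) := by
    refine L.ret_eq (L.ret_pos _ _) ?_ fun i hi hi' => ?_
    · rw [hlev _ le_rfl]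
      exact L.le_lev_iterate_ret _ _
    · rw [hlev _ hi'.le]
      exact L.lev_iterate_lt_of_lt_ret hi hi'
  rw [h1, vtx, h2, vtx, Prod.mk.injEq]
  exact ⟨L.word_eq_iff.2 ⟨hret, fun i hi => (hy i (Finset.mem_range.2 (by omega))).2⟩, rfl⟩

/-! ### Vertices and edges -/

/-- The vertices of level `n`: the labels of the towers over `{x | n ≤ lev x}`. -/
def Vert (n : ℕ) : Type := {l : List (ℕ × Finset ℕ) // ∃ x, L.vtx n x = l}

/-- The edges from level `n` to level `n + 1`: a tower of level `n + 1` with a height in it at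
which a tower of level `n` begins. -/
def Edge (n : ℕ) : Type := {p : List (ℕ × Finset ℕ) × ℕ //
  ∃ x, n ≤ L.lev x ∧ L.vtx (n + 1) x = p.1 ∧ L.back (n + 1) x = p.2}

/-- The vertex of level `n` of a point. -/
noncomputable def toVert (n : ℕ) (x : X) : L.Vert n := ⟨L.vtx n x, x, rfl⟩

/-- The edge of a point between the levels `n` and `n + 1`. -/
noncomputable def edge (n : ℕ) (x : X) : L.Edge n :=
  ⟨(L.vtx (n + 1) x, L.back (n + 1) (L.base n x)), L.base n x, L.le_lev_base n x,
    L.vtx_succ_base n x, rfl⟩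

/-- The source of an edge. -/
noncomputable def src (n : ℕ) (e : L.Edge n) : L.Vert n := L.toVert n e.2.choose

/-- The range of an edge. -/
def tgt (n : ℕ) (e : L.Edge n) : L.Vert (n + 1) := ⟨e.1.1, let ⟨x, hx⟩ := e.2; ⟨x, hx.2.1⟩⟩

instance (n : ℕ) : PartialOrder (L.Edge n) where
  le e f := e.1.1 = f.1.1 ∧ e.1.2 ≤ f.1.2
  le_refl e := ⟨rfl, le_rfl⟩
  le_trans e f g h h' := ⟨h.1.trans h'.1, h.2.trans h'.2⟩
  le_antisymm e f h h' := Subtype.ext (Prod.ext h.1 (le_antisymm h.2 h'.2))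

variable {L}

theorem toVert_eq_iff {n : ℕ} {x y : X} : L.toVert n x = L.toVert n y ↔ L.vtx n x = L.vtx n y :=
  Subtype.ext_iff

theorem exists_toVert_eq {n : ℕ} (v : L.Vert n) : ∃ x, n ≤ L.lev x ∧ L.toVert n x = v := by
  obtain ⟨_, x, rfl⟩ := v
  exact ⟨L.base n x, L.le_lev_base n x, toVert_eq_iff.2 (L.vtx_base n x)⟩

theorem edge_le_iff {n : ℕ} {e f : L.Edge n} : e ≤ f ↔ e.1.1 = f.1.1 ∧ e.1.2 ≤ f.1.2 := Iff.rfl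

theorem edge_eq_iff {n : ℕ} {x y : X} : L.edge n x = L.edge n y ↔
    L.vtx (n + 1) x = L.vtx (n + 1) y ∧
      L.back (n + 1) (L.base n x) = L.back (n + 1) (L.base n y) :=
  Subtype.ext_iff.trans Prod.mk_inj

theorem edge_fst (n : ℕ) (x : X) : (L.edge n x).1.1 = L.vtx (n + 1) x := rfl

theorem edge_snd (n : ℕ) (x : X) : (L.edge n x).1.2 = L.back (n + 1) (L.base n x) := rfl

theorem exists_edge_eq {n : ℕ} (e : L.Edge n) : ∃ x, n ≤ L.lev x ∧ L.edge n x = e := by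
  obtain ⟨⟨l, i⟩, x, hx, h1, h2⟩ := e
  refine ⟨x, hx, Subtype.ext (Prod.ext h1 ?_)⟩
  rw [edge_snd, L.base_eq_self hx]
  exact h2

@[simp]
theorem tgt_edge (n : ℕ) (x : X) : L.tgt n (L.edge n x) = L.toVert (n + 1) x := rfl

-- The source is defined by choosing a point that realizes the edge. The choice does not matter,
-- since the tower of level `n + 1` and the height in it fix the tower of level `n`.
@[simp]
theorem src_edge (n : ℕ) (x : X) : L.src n (L.edge n x) = L.toVert n x := by
  obtain ⟨-, h1, h2⟩ := (L.edge n x).2.choose_spec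
  rw [src, toVert_eq_iff]
  have h1' := h1.trans (L.vtx_succ_base n x).symm
  rw [(L.atom_of_succ h1' h2).1, L.vtx_base]

theorem edge_base (n : ℕ) (x : X) : L.edge n (L.base n x) = L.edge n x :=
  edge_eq_iff.2 ⟨L.vtx_succ_base n x, by rw [L.base_eq_self (L.le_lev_base n x)]⟩

/-- All the edges ending at a given vertex are realized along a single orbit segment. -/
theorem edge_iterate {n : ℕ} {w : X} (hw : n + 1 ≤ L.lev w) {e : L.Edge n}
    (he : L.tgt n e = L.toVert (n + 1) w) : e.1.2 < L.ret (n + 1) w ∧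
      n ≤ L.lev (T^[e.1.2] w) ∧ L.edge n (T^[e.1.2] w) = e := by
  obtain ⟨x, hx, rfl⟩ := exists_edge_eq e
  rw [tgt_edge, toVert_eq_iff, L.vtx_eq_word hw] at he
  obtain ⟨hr, hc⟩ := L.word_eq_iff.1 he
  have hp : (L.edge n x).1.2 = L.back (n + 1) x := by rw [edge_snd, L.base_eq_self hx]
  have hlt := L.back_lt_ret (n + 1) x
  have hl := L.lev_eq_of_code (by omega) (hc _ hlt)
  rw [L.iterate_base] at hl
  rw [hp]
  refine ⟨hr ▸ hlt, hl ▸ hx, edge_eq_iff.2 ⟨?_, ?_⟩⟩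
  · rw [vtx, L.base_iterate_of_lt hw (hr ▸ hlt), he]
  · rw [L.base_eq_self (hl ▸ hx), L.base_eq_self hx, L.back_iterate_of_lt hw (hr ▸ hlt)]

theorem edge_iterate_val {n k : ℕ} {w : X} (hw : n + 1 ≤ L.lev w) (hk : k < L.ret (n + 1) w)
    (hkl : n ≤ L.lev (T^[k] w)) : (L.edge n (T^[k] w)).1 = (L.vtx (n + 1) w, k) := by
  refine Prod.ext ?_ ?_
  · rw [edge_fst, vtx, L.base_iterate_of_lt hw hk, L.vtx_eq_word hw]
  · rw [edge_snd, L.base_eq_self hkl, L.back_iterate_of_lt hw hk]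

theorem tgt_fiber_finite (n : ℕ) (v : L.Vert (n + 1)) : {e | L.tgt n e = v}.Finite := by
  obtain ⟨w, hw, rfl⟩ := exists_toVert_eq v
  refine Set.Finite.of_injOn (f := fun e : L.Edge n => e.1.2) (t := Set.Iio (L.ret (n + 1) w))
    (fun e he => (edge_iterate hw he).1) (fun e he f hf h => ?_) (Set.finite_Iio _)
  exact Subtype.ext (Prod.ext (congrArg Subtype.val (he.trans hf.symm)) h)

theorem isMin_edge_iff {n : ℕ} {x : X} : IsMin (L.edge n x) ↔ n + 1 ≤ L.lev (L.base n x) := by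
  constructor
  · intro h
    have hb := L.le_lev_base (n + 1) x
    have h1 : L.edge n (L.base (n + 1) x) ≤ L.edge n x := by
      refine ⟨L.vtx_base (n + 1) x, ?_⟩
      rw [edge_snd, L.base_eq_self ((Nat.le_succ n).trans hb), L.back_eq_zero hb]
      exact Nat.zero_le _
    have h2 := (h h1).2
    rw [← L.back_eq_zero_iff]
    simpa [edge, L.base_eq_self ((Nat.le_succ n).trans hb), L.back_eq_zero hb] using h2
  · intro h f hf
    refine ⟨hf.1.symm, ?_⟩
    simp [edge, L.back_eq_zero h]

/-- Otherwise a tower of level `n` would begin strictly above `base n x` and no later than `x`,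
against the choice of `base n x` as the last visit. This identifies the edge of `x` as the highest
one starting at or below `x`. -/
theorem snd_le_edge_snd {n : ℕ} {x : X} {f : L.Edge n} (hf : L.tgt n f = L.toVert (n + 1) x)
    (hfx : f.1.2 ≤ L.back (n + 1) x) : f.1.2 ≤ (L.edge n x).1.2 := by
  obtain ⟨-, h2, -⟩ := edge_iterate (e := f) (L.le_lev_base (n + 1) x)
    (hf.trans (toVert_eq_iff.2 (L.vtx_base (n + 1) x).symm))
  rw [edge_snd, L.back_succ_base]
  by_contra! hlt
  have hle := L.back_le_succ n x
  have h3 := L.lev_iterate_base_lt (n := n) (x := x)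
    (i := f.1.2 - (L.back (n + 1) x - L.back n x)) (by omega) (by omega)
  rw [L.base_eq_iterate n x, ← Function.iterate_add_apply, Nat.sub_add_cancel hlt.le] at h3
  omega

/-- The hypothesis puts `x` at the top of its tower of level `n`. Its edge is then maximal exactly
when the tower of level `n + 1` ends there as well. -/
theorem isMax_edge_iff {n : ℕ} {x : X} (hx : n ≤ L.lev (T x)) :
    IsMax (L.edge n x) ↔ n + 1 ≤ L.lev (T x) := by
  constructor
  · intro h
    by_contra! hlt
    have h1 : L.edge n x ≤ L.edge n (T x) := by
      refine ⟨?_, ?_⟩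
      · simp only [edge, vtx, L.base_map hlt]
      · simp only [edge, L.base_eq_self hx, L.back_map hlt, L.back_succ_base]
        omega
    have h2 := (h h1).2
    simp only [edge, L.base_eq_self hx, L.back_map hlt, L.back_succ_base] at h2
    omega
  · intro h f hf
    have hw := L.le_lev_base (n + 1) x
    have htgt : L.tgt n f = L.toVert (n + 1) x := Subtype.ext hf.1.symm
    obtain ⟨h1, -, -⟩ := edge_iterate (e := f) hw
      (htgt.trans (toVert_eq_iff.2 (L.vtx_base (n + 1) x).symm))
    have hret : L.ret (n + 1) (L.base (n + 1) x) = L.back (n + 1) x + 1 := by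
      refine L.ret_eq (Nat.succ_pos _) ?_ fun i hi hi' => L.lev_iterate_base_lt hi (by omega)
      rwa [Function.iterate_succ_apply', L.iterate_base]
    exact ⟨hf.1.symm, snd_le_edge_snd htgt (by omega)⟩

/-- Heights add up: `back (n + 1) x` is the height of the edge of `x` plus `back n x`. -/
theorem forall_edge_eq_iff {n : ℕ} {x y : X} : (∀ i < n, L.edge i x = L.edge i y) ↔
    L.vtx n x = L.vtx n y ∧ L.back n x = L.back n y := by
  induction n with
  | zero => simp [L.vtx_zero x y, L.back_eq_zero (Nat.zero_le _)]
  | succ n ih =>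
    rw [Nat.forall_lt_succ_right, ih, edge_eq_iff, L.back_succ_base, L.back_succ_base]
    have h1 := L.back_le_succ n x
    have h2 := L.back_le_succ n y
    constructor
    · rintro ⟨⟨-, h3⟩, h4, h5⟩
      exact ⟨h4, by omega⟩
    · rintro ⟨h3, h4⟩
      obtain ⟨h5, h6⟩ := L.atom_of_succ h3 h4
      exact ⟨⟨h5, h6⟩, h3, by omega⟩

theorem isLocallyConstant_edge (n : ℕ) : IsLocallyConstant (L.edge n) := by
  rw [IsLocallyConstant.iff_eventually_eq]
  intro x
  filter_upwards [(IsLocallyConstant.iff_eventually_eq _).1 (L.isLocallyConstant_atom (n + 1)) x]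
    with y hy
  rw [Prod.mk.injEq] at hy
  exact forall_edge_eq_iff.2 hy n (Nat.lt_succ_self n)

/-- A cylinder of length `n` is one floor of one tower, and the letter read on that floor records
membership in `U i` for all `i < n`. -/
theorem mem_U_iff_of_path {n i : ℕ} (hi : i < n) {x y : X}
    (h : ∀ j < n, L.edge j x = L.edge j y) : x ∈ L.U i ↔ y ∈ L.U i := by
  obtain ⟨h1, h2⟩ := forall_edge_eq_iff.1 h
  exact ((L.code_eq_iff (by omega)).1 (L.code_eq_of_vtx h1 h2)).2 i hi

/-! ### The diagram and the coding map -/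

variable (L) in
/-- The Borel–Bratteli diagram of a level function. -/
noncomputable def diagram [Nonempty X] : BorelBratteli where
  V := L.Vert
  E := L.Edge
  s := L.src
  r := L.tgt
  v₀ := L.toVert 0 (Classical.arbitrary X)
  eq_v₀ v := by
    obtain ⟨x, -, rfl⟩ := exists_toVert_eq v
    exact toVert_eq_iff.2 (L.vtx_zero _ _)
  countable_V n := inferInstanceAs (Countable {l : List (ℕ × Finset ℕ) // ∃ x, L.vtx n x = l})
  countable_E n := inferInstanceAs (Countable {p : List (ℕ × Finset ℕ) × ℕ //
    ∃ x, n ≤ L.lev x ∧ L.vtx (n + 1) x = p.1 ∧ L.back (n + 1) x = p.2})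
  source_nonempty n v := by
    obtain ⟨x, -, rfl⟩ := exists_toVert_eq v
    exact ⟨L.edge n x, src_edge n x⟩
  range_nonempty n v := by
    obtain ⟨x, -, rfl⟩ := exists_toVert_eq v
    exact ⟨L.edge n x, tgt_edge n x⟩
  range_finite n v := tgt_fiber_finite n v

variable [Nonempty X]

variable (L) in
/-- The coding of the points of `X` by paths. -/
noncomputable def path (x : X) : L.diagram.PathSpace :=
  ⟨fun n => L.edge n x, fun n => src_edge (n + 1) x⟩

/-- Every finite initial path is read off some point, so the cylinders along `y` pull back to a
decreasing sequence of non-empty closed sets. They lie in a compact set, hence have a common point.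
-/
theorem path_surjective : Function.Surjective L.path := by
  intro y
  have hlift : ∀ n x, n ≤ L.lev x → L.toVert n x = L.src n (y.1 n) →
      ∃ z, L.base n z = x ∧ ∀ i < n, L.edge i z = y.1 i := by
    intro n
    induction n with
    | zero => exact fun x hx _ => ⟨x, L.base_eq_self hx, by simp⟩
    | succ n ih =>
      intro x hx hxv
      -- Descend one level: in the tower over `x`, climb to the position prescribed by `y.1 n`,
      -- which is the base of the right tower of level `n`.
      obtain ⟨h1, h2, h3⟩ := edge_iterate (e := y.1 n) hx ((hxv.trans (y.2 n)).symm)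
      obtain ⟨z, hz, hz'⟩ := ih _ h2 (by rw [← src_edge, h3])
      refine ⟨z, ?_, ?_⟩
      · rw [← L.base_succ_base, hz, L.base_iterate_of_lt hx h1]
      · rw [Nat.forall_lt_succ_right]
        refine ⟨hz', ?_⟩
        rw [← edge_base, hz, h3]
  have hclosed : ∀ n, IsClosed {x | ∀ i < n + 1, L.edge i x = y.1 i} := by
    intro n
    simp only [ofPred_forall]
    exact isClosed_iInter fun i => isClosed_iInter fun _ =>
      (isLocallyConstant_edge i).isClosed_fiber _
  obtain ⟨p, -, hp⟩ := exists_edge_eq (y.1 0)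
  -- The first edge already fixes the letter of level one, hence `lev`, so this cylinder lies in a
  -- compact sublevel set.
  have hcomp : IsCompact {x | ∀ i < 0 + 1, L.edge i x = y.1 i} := by
    refine (L.isCompact_lev (L.lev p + 1)).of_isClosed_subset (hclosed 0) fun x hx => ?_
    have h : ∀ i < 1, L.edge i x = L.edge i p := fun i hi => by
      obtain rfl : i = 0 := by omega
      rw [hx 0 (by omega), hp]
    obtain ⟨h1, h2⟩ := forall_edge_eq_iff.1 h
    have := L.lev_eq_of_code le_rfl (L.code_eq_of_vtx h1 h2)
    simp [this]
  obtain ⟨x, hx⟩ := IsCompact.nonempty_iInter_of_sequence_nonempty_isCompact_isClosed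
    (fun n => {x | ∀ i < n + 1, L.edge i x = y.1 i}) (fun n x hx i hi => hx i (by omega))
    (fun n => by
      obtain ⟨x, hx, hx'⟩ := exists_toVert_eq (L.src (n + 1) (y.1 (n + 1)))
      obtain ⟨z, -, hz⟩ := hlift (n + 1) x hx hx'
      exact ⟨z, hz⟩) hcomp hclosed
  refine ⟨x, Subtype.ext (funext fun n => ?_)⟩
  exact (mem_iInter.1 hx n) n (by omega)

theorem path_injective [T1Space X] : Function.Injective L.path := by
  intro x y h
  by_contra hne
  obtain ⟨i, hx, hi⟩ := L.exists_subset x {y}ᶜ isOpen_compl_singleton hne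
  exact hi ((mem_U_iff_of_path (Nat.lt_succ_self i)
    fun j _ => congrFun (congrArg Subtype.val h) j).1 hx) rfl

theorem isInducing_path : IsInducing L.path := by
  rw [isInducing_iff_nhds]
  intro x
  refine le_antisymm ?_ fun O hO => ?_
  · rw [← Filter.tendsto_iff_comap]
    refine Continuous.tendsto (continuous_induced_rng.2 ?_) x
    exact @continuous_pi _ _ _ _ (fun _ => ⊥) _ fun n =>
      @IsLocallyConstant.continuous _ _ _ ⊥ _ (isLocallyConstant_edge n)
  · obtain ⟨O', hO', hopen, hxO⟩ := mem_nhds_iff.1 hO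
    obtain ⟨i, hx, hi⟩ := L.exists_subset x O' hopen hxO
    have hcyl : {z : L.diagram.PathSpace | ∀ j < i + 1, z.1 j = L.edge j x} ∈ 𝓝 (L.path x) := by
      refine IsOpen.mem_nhds ?_ fun j _ => rfl
      have hev : ∀ (j : ℕ) (e : L.Edge j),
          IsOpen {z : L.diagram.PathSpace | z.1 j = e} := by
        intro j e
        let _ : ∀ n, TopologicalSpace (L.diagram.E n) := fun _ => ⊥
        have h1 : Continuous fun z : L.diagram.PathSpace => z.1 j :=
          (continuous_apply j).comp continuous_induced_dom
        have : DiscreteTopology (L.diagram.E j) := ⟨rfl⟩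
        exact (isOpen_discrete ({e} : Set (L.diagram.E j))).preimage h1
      have : {z : L.diagram.PathSpace | ∀ j < i + 1, z.1 j = L.edge j x} =
          ⋂ j ∈ Set.Iio (i + 1), {z : L.diagram.PathSpace | z.1 j = L.edge j x} := by
        ext z
        simp
      rw [this]
      exact (Set.finite_Iio _).isOpen_biInter fun j _ => hev j _
    refine ⟨_, hcyl, fun z hz => hO' (hi ?_)⟩
    exact (mem_U_iff_of_path (Nat.lt_succ_self i) hz).2 hx

end LevelFunction

namespace LevelFunction

variable {T : X ≃ₜ X} {L : LevelFunction T}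

/-! ### The order -/

theorem lev_eq_of_map_lt {n : ℕ} {x : X} (hx : n ≤ L.lev x) (hTx : L.lev (T x) < n) :
    L.lev x = n := by
  have := L.lev_le x
  omega

theorem back_pos {n : ℕ} {x : X} (hx : L.lev x < n) : 0 < L.back n x := by
  rw [Nat.pos_iff_ne_zero, ne_eq, L.back_eq_zero_iff]
  omega

theorem lev_map_base_lt {n : ℕ} {x : X} (hx : L.lev x < n) : L.lev (T (L.base n x)) < n :=
  L.lev_iterate_base_lt (i := 1) one_pos (back_pos hx)

/-- As `lev` drops by at most one per step, a descent below `n` starts from level exactly `n`. Such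
a base is not a base at level `n + 1`, which excludes minimal edges at all levels above `lev x`. -/
theorem lev_base_eq {n : ℕ} {x : X} (hx : L.lev x < n) : L.lev (L.base n x) = n :=
  lev_eq_of_map_lt (L.le_lev_base n x) (lev_map_base_lt hx)

theorem not_isMin_edge {n : ℕ} {x : X} (hx : L.lev x < n) : ¬ IsMin (L.edge n x) := by
  rw [isMin_edge_iff, lev_base_eq hx]
  omega

/-- The last point of a tower of height at least two, the preceding ones, and the height. -/
theorem lev_last {n : ℕ} {w : X} (hw : n ≤ L.lev w) (hTw : L.lev (T w) < n) :
    4 ≤ L.ret n w ∧ (∀ i, 1 ≤ i → i ≤ 3 → L.lev (T^[L.ret n w - i] w) + 1 = n) ∧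
      L.lev (T (T^[L.ret n w - 1] w)) = n := by
  have hpos := L.ret_pos n w
  have hne : L.ret n w ≠ 1 := by
    rw [ne_eq, L.ret_eq_one_iff]
    omega
  have hT : T (T^[L.ret n w - 1] w) = T^[L.ret n w] w := by
    rw [← Function.iterate_succ_apply' T, Nat.succ_eq_add_one, Nat.sub_add_cancel hpos]
  have h1 := L.lev_iterate_lt_of_lt_ret (n := n) (x := w) (i := L.ret n w - 1)
    (by omega) (by omega)
  have h2 := L.le_lev_iterate_ret n w
  rw [← hT] at h2
  obtain ⟨h3, h4, h5⟩ := L.lev_eq_of_lt _ (h1.trans_le h2)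
  have e1 : T.symm (T^[L.ret n w - 1] w) = T^[L.ret n w - 2] w := by
    have := T.symm_iterate_iterate (m := 1) (k := L.ret n w - 1) (by omega) w
    rwa [Nat.sub_sub] at this
  rw [e1] at h4 h5
  have hne2 : L.ret n w ≠ 2 := by
    intro h
    rw [h] at h4 h1
    simp only [Nat.sub_self, Function.iterate_zero, id] at h4
    omega
  have e2 : T.symm (T^[L.ret n w - 2] w) = T^[L.ret n w - 3] w := by
    have := T.symm_iterate_iterate (m := 1) (k := L.ret n w - 2) (by omega) w
    rwa [Nat.sub_sub] at this
  rw [e2] at h5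
  have hne3 : L.ret n w ≠ 3 := by
    intro h
    rw [h] at h5 h1
    simp only [Nat.sub_self, Function.iterate_zero, id] at h5
    omega
  refine ⟨by omega, fun i hi hi' => ?_, by omega⟩
  -- The three points before the return have the same level, and the rise by one ends at level `n`.
  -- Heights two and three were excluded because the base, of level at least `n`, would be one of
  -- these points.
  obtain rfl | rfl | rfl : i = 1 ∨ i = 2 ∨ i = 3 := by omega
  all_goals omega

/-- A tall tower of level `n` is left to a point of level exactly `n`, so the surrounding tower of
level `n + 1` continues. The edge is tested at the top point of the tower, where `isMax_edge_iff`
applies. -/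
theorem not_isMax_edge {n : ℕ} {x : X} (hx : L.lev x < n) : ¬ IsMax (L.edge n x) := by
  have hw := L.le_lev_base n x
  obtain ⟨h1, -, h3⟩ := lev_last hw (lev_map_base_lt hx)
  have he : L.edge n (T^[L.ret n (L.base n x) - 1] (L.base n x)) = L.edge n x := by
    rw [← edge_base, L.base_iterate_of_lt hw (by omega), edge_base]
  rw [← he, isMax_edge_iff h3.ge, h3]
  omega

theorem tgt_eq_tgt_iff {n : ℕ} {e f : L.Edge n} : (e ≤ f ∨ f ≤ e) ↔ L.tgt n e = L.tgt n f := by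
  constructor
  · rintro (h | h)
    · exact Subtype.ext h.1
    · exact Subtype.ext h.1.symm
  · intro h
    have h' : e.1.1 = f.1.1 := congrArg Subtype.val h
    exact (le_total e.1.2 f.1.2).imp (fun h => ⟨h', h⟩) fun h => ⟨h'.symm, h⟩

variable (L) in
/-- The ordered Borel–Bratteli diagram of a level function. -/
noncomputable def orderedDiagram [Nonempty X] : OrderedBorelBratteli where
  toBorelBratteli := L.diagram
  order n := inferInstanceAs (PartialOrder (L.Edge n))
  comparable_iff _ _ _ := tgt_eq_tgt_iff
  no_cofinal_max y := by
    obtain ⟨x, rfl⟩ := path_surjective y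
    rintro ⟨N, hN⟩
    exact not_isMax_edge (Nat.lt_succ_of_le (le_max_right N (L.lev x)))
      (hN _ ((le_max_left N (L.lev x)).trans (Nat.le_succ _)))
  no_cofinal_min y := by
    obtain ⟨x, rfl⟩ := path_surjective y
    rintro ⟨N, hN⟩
    exact not_isMin_edge (Nat.lt_succ_of_le (le_max_right N (L.lev x)))
      (hN _ ((le_max_left N (L.lev x)).trans (Nat.le_succ _)))

theorem edge_covBy {x : X} : L.edge (L.lev (T x)) x ⋖ L.edge (L.lev (T x)) (T x) := by
  set k := L.lev (T x) with hk
  have hlt : L.lev (T x) < k + 1 := by omega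
  have hb := L.back_map hlt
  have hv : L.vtx (k + 1) (T x) = L.vtx (k + 1) x := by rw [vtx, L.base_map hlt, vtx]
  have hs : (L.edge k (T x)).1.2 = L.back (k + 1) x + 1 := by
    rw [edge_snd, L.base_eq_self hk.le, hb]
  refine ⟨lt_of_le_of_ne ⟨hv.symm, ?_⟩ fun h => ?_, fun c h1 h2 => ?_⟩
  · rw [hs, edge_snd, L.back_succ_base]
    omega
  · have := congrArg (fun e : L.Edge k => e.1.2) h
    simp only [hs, edge_snd, L.back_succ_base] at this
    omega
  · have h3 : c.1.2 ≠ (L.edge k (T x)).1.2 := fun h => h2.ne (Subtype.ext (Prod.ext h2.le.1 h))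
    have h4 := h2.le.2
    have h5 := snd_le_edge_snd (f := c) (x := x) (Subtype.ext h1.le.1.symm) (by omega)
    exact h1.not_ge ⟨h1.le.1.symm, h5⟩

variable [Nonempty X]

/-- Put `k = lev (T x)`. At each level up to `k`, `T x` starts a new tower; for `i < k` this makes
edge `i` of `x` maximal and that of `T x` minimal. At levels above `k`, both points lie in the same
tower, so edge `k` moves to its successor and later edges do not change. -/
theorem isVershikImage_path (x : X) :
    L.orderedDiagram.IsVershikImage (L.path x) (L.path (T x)) := by
  refine ⟨L.lev (T x), fun i hi => ?_, ?_, edge_covBy, fun i hi => ?_, fun i hi => ?_⟩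
  · exact (isMax_edge_iff hi.le).2 hi
  · intro h
    exact absurd ((isMax_edge_iff le_rfl).1 h) (by omega)
  · refine edge_eq_iff.2 ⟨?_, ?_⟩
    · rw [vtx, L.base_map (by omega), vtx]
    · rw [L.base_map hi]
  · refine isMin_edge_iff.2 ?_
    rw [L.base_eq_self hi.le]
    exact hi

theorem path_map (x : X) : L.path (T x) = L.orderedDiagram.vershik (L.path x) :=
  OrderedBorelBratteli.IsVershikImage.unique _ (isVershikImage_path x)
    (L.orderedDiagram.isVershikImage_vershik _)

end LevelFunction

namespace LevelFunction

variable {T : X ≃ₜ X} {L : LevelFunction T}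

/-! ### The special structure -/

variable (L) in
/-- The towers of level `n` with base in `{x | lev x = j}`. -/
def vertClass (n j : ℕ) : Set (L.Vert n) := {v | ∃ x, n ≤ L.lev x ∧ L.lev x = j ∧ L.toVert n x = v}

variable (L) in
/-- The towers of level `n` of height at least two. -/
def tallClass (n : ℕ) : Set (L.Vert n) :=
  {v | ∃ x, n ≤ L.lev x ∧ L.lev (T x) < n ∧ L.toVert n x = v}

variable (L) in
/-- The towers of level `n` of height one with base in `{x | lev x = n}`. -/
def flatClass (n : ℕ) : Set (L.Vert n) :=
  {v | ∃ x, L.lev x = n ∧ n ≤ L.lev (T x) ∧ L.toVert n x = v}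

theorem toVert_eq_iff_word {n : ℕ} {x y : X} (hx : n ≤ L.lev x) (hy : n ≤ L.lev y) :
    L.toVert n x = L.toVert n y ↔ L.word n x = L.word n y := by
  rw [toVert_eq_iff, L.vtx_eq_word hx, L.vtx_eq_word hy]

theorem lev_eq_of_toVert {n : ℕ} (hn : 1 ≤ n) {x y : X} (hx : n ≤ L.lev x) (hy : n ≤ L.lev y)
    (h : L.toVert n x = L.toVert n y) : L.lev x = L.lev y :=
  L.lev_eq_of_word hn ((toVert_eq_iff_word hx hy).1 h)

theorem le_lev_map_iff_of_toVert {n : ℕ} {x y : X} (hx : n ≤ L.lev x) (hy : n ≤ L.lev y)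
    (h : L.toVert n x = L.toVert n y) : n ≤ L.lev (T x) ↔ n ≤ L.lev (T y) := by
  rw [← L.ret_eq_one_iff, ← L.ret_eq_one_iff, (L.word_eq_iff.1 ((toVert_eq_iff_word hx hy).1 h)).1]

theorem toVert_mem_vertClass {n j : ℕ} (hn : 1 ≤ n) {x : X} (hx : n ≤ L.lev x) :
    L.toVert n x ∈ L.vertClass n j ↔ L.lev x = j := by
  constructor
  · rintro ⟨y, hy, rfl, h⟩
    exact (lev_eq_of_toVert hn hy hx h).symm
  · exact fun h => ⟨x, hx, h, rfl⟩

theorem toVert_mem_tallClass {n : ℕ} {x : X} (hx : n ≤ L.lev x) :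
    L.toVert n x ∈ L.tallClass n ↔ L.lev (T x) < n := by
  constructor
  · rintro ⟨y, hy, hy', h⟩
    rwa [← not_le, ← le_lev_map_iff_of_toVert hy hx h, not_le]
  · exact fun h => ⟨x, hx, h, rfl⟩

theorem toVert_mem_flatClass {n : ℕ} (hn : 1 ≤ n) {x : X} (hx : n ≤ L.lev x) :
    L.toVert n x ∈ L.flatClass n ↔ L.lev x = n ∧ n ≤ L.lev (T x) := by
  constructor
  · rintro ⟨y, rfl, hy', h⟩
    exact ⟨(lev_eq_of_toVert hn le_rfl hx h).symm, (le_lev_map_iff_of_toVert le_rfl hx h).1 hy'⟩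
  · exact fun h => ⟨x, h.1, h.2, rfl⟩

variable (L) in
theorem exists_lev_eq (j : ℕ) : ∃ x, L.lev x = j := by
  rcases j.eq_zero_or_pos with rfl | hj
  · obtain ⟨x, -, -, hx, -⟩ := L.exists_split 1 le_rfl
    exact ⟨T x, by omega⟩
  · obtain ⟨x, -, hx, hx', -⟩ := L.exists_split j hj
    exact ⟨x, lev_eq_of_map_lt hx hx'⟩

/-- A locally constant map takes finitely many values on the compact set `{x | lev x = j}`. -/
theorem vertClass_finite (n j : ℕ) : (L.vertClass n j).Finite := by
  let _ : TopologicalSpace (L.Vert n) := ⊥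
  have : DiscreteTopology (L.Vert n) := ⟨rfl⟩
  have hcomp : IsCompact {x | L.lev x = j} :=
    (L.isCompact_lev (j + 1)).of_isClosed_subset (L.isLocallyConstant_lev.isClosed_fiber j)
      fun x (hx : L.lev x = j) => show L.lev x < j + 1 by omega
  have hloc : IsLocallyConstant (L.toVert n) := by
    rw [IsLocallyConstant.iff_eventually_eq]
    intro x
    filter_upwards [(IsLocallyConstant.iff_eventually_eq _).1 (L.isLocallyConstant_atom n) x]
      with y hy
    exact toVert_eq_iff.2 (Prod.mk.inj hy).1
  refine (hcomp.image hloc.continuous).finite_of_discrete.subset ?_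
  rintro _ ⟨x, -, hx, rfl⟩
  exact ⟨x, hx, rfl⟩

theorem tallClass_subset (n : ℕ) : L.tallClass n ⊆ L.vertClass n n := by
  rintro _ ⟨x, hx, hx', rfl⟩
  exact ⟨x, hx, lev_eq_of_map_lt hx hx', rfl⟩

theorem flatClass_subset (n : ℕ) : L.flatClass n ⊆ L.vertClass n n := by
  rintro _ ⟨x, hx, -, rfl⟩
  exact ⟨x, hx.ge, hx, rfl⟩

theorem vertClass_self (n : ℕ) : L.vertClass n n = L.tallClass n ∪ L.flatClass n := by
  refine Subset.antisymm ?_ (union_subset (tallClass_subset n) (flatClass_subset n))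
  rintro _ ⟨x, hx, hx', rfl⟩
  rcases lt_or_ge (L.lev (T x)) n with h | h
  · exact Or.inl ⟨x, hx, h, rfl⟩
  · exact Or.inr ⟨x, hx', h, rfl⟩

theorem disjoint_tallClass_flatClass (n : ℕ) : Disjoint (L.tallClass n) (L.flatClass n) := by
  rw [Set.disjoint_left]
  rintro _ ⟨x, hx, hx', rfl⟩ ⟨y, hy, hy', h⟩
  have := (le_lev_map_iff_of_toVert hy.ge hx h).1 hy'
  omega

theorem disjoint_vertClass {n : ℕ} (hn : 1 ≤ n) {j j' : ℕ} (h : j ≠ j') :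
    Disjoint (L.vertClass n j) (L.vertClass n j') := by
  rw [Set.disjoint_left]
  rintro _ ⟨x, hx, hx', rfl⟩ hj'
  rw [toVert_mem_vertClass hn hx] at hj'
  exact h (hx'.symm.trans hj')

/-- The first letter of a word of level `n ≥ 1` records membership in `U 0`, which separates two
entrance points. -/
theorem exists_split_toVert {n j : ℕ} (hn : 1 ≤ n) (hj : n ≤ j) : ∃ x y, j ≤ L.lev x ∧
    L.lev (T x) < j ∧ j ≤ L.lev y ∧ L.lev (T y) < j ∧ L.toVert n x ≠ L.toVert n y := by
  obtain ⟨x, y, h1, h2, h3, h4, h5, h6⟩ := L.exists_split j (hn.trans hj)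
  refine ⟨x, y, h1, h2, h3, h4, fun h => h6 ?_⟩
  have := (L.word_eq_iff.1 ((toVert_eq_iff_word (hj.trans h1) (hj.trans h3)).1 h)).2 0
    (L.ret_pos _ _)
  exact (((L.code_eq_iff hn).1 this).2 0 hn).1 h5

theorem two_le_ncard_vertClass {n j : ℕ} (hn : 1 ≤ n) (hj : n ≤ j) :
    2 ≤ (L.vertClass n j).ncard := by
  obtain ⟨x, y, h1, h2, h3, h4, h5⟩ := exists_split_toVert (L := L) hn hj
  exact (Set.one_lt_ncard (vertClass_finite n j)).2
    ⟨_, ⟨x, hj.trans h1, lev_eq_of_map_lt h1 h2, rfl⟩,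
      _, ⟨y, hj.trans h3, lev_eq_of_map_lt h3 h4, rfl⟩, h5⟩

theorem two_le_ncard_tallClass {n : ℕ} (hn : 1 ≤ n) : 2 ≤ (L.tallClass n).ncard := by
  obtain ⟨x, y, h1, h2, h3, h4, h5⟩ := exists_split_toVert (L := L) hn le_rfl
  exact (Set.one_lt_ncard ((vertClass_finite n n).subset (tallClass_subset n))).2
    ⟨_, ⟨x, h1, h2, rfl⟩, _, ⟨y, h3, h4, rfl⟩, h5⟩

/-- Every edge is read off an orbit segment forming a tower of level `n + 1`. -/
theorem exists_edge_iterate {n : ℕ} (e : L.Edge n) : ∃ w k, n + 1 ≤ L.lev w ∧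
    k < L.ret (n + 1) w ∧ n ≤ L.lev (T^[k] w) ∧ L.edge n (T^[k] w) = e ∧
      L.tgt n e = L.toVert (n + 1) w := by
  obtain ⟨w, hw, h⟩ := exists_toVert_eq (L.tgt n e)
  obtain ⟨h1, h2, h3⟩ := edge_iterate hw h.symm
  exact ⟨w, e.1.2, hw, h1, h2, h3, h.symm⟩

theorem lev_iterate_eq {n k : ℕ} {w : X} (hk : 0 < k) (hkr : k < L.ret (n + 1) w)
    (hkl : n ≤ L.lev (T^[k] w)) : L.lev (T^[k] w) = n := by
  have := L.lev_iterate_lt_of_lt_ret hk hkr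
  omega

theorem ncard_tgt_fiber_eq_one {n : ℕ} {w : X} (hw : n + 1 ≤ L.lev w)
    (hTw : n + 1 ≤ L.lev (T w)) :
    {e | L.tgt n e = L.toVert (n + 1) w}.ncard = 1 := by
  rw [Set.ncard_eq_one]
  refine ⟨L.edge n w, Subset.antisymm (fun e he => ?_) ?_⟩
  · obtain ⟨h1, -, h3⟩ := edge_iterate hw he
    rw [L.ret_eq_one_iff.2 hTw, Nat.lt_one_iff] at h1
    rw [h1] at h3
    exact h3.symm
  · rintro _ rfl
    rfl

theorem four_le_ncard_tgt_fiber {n : ℕ} {w : X} (hw : n + 1 ≤ L.lev w)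
    (hTw : L.lev (T w) < n + 1) :
    4 ≤ {e | L.tgt n e = L.toVert (n + 1) w}.ncard := by
  obtain ⟨h1, h2, -⟩ := lev_last hw hTw
  set r := L.ret (n + 1) w with hr
  -- Towers of level `n` begin at the base and at each of the last three floors, which have level
  -- `n`. These heights are distinct as `4 ≤ r`.
  have hS : ∀ k ∈ ({0, r - 3, r - 2, r - 1} : Finset ℕ), k < r ∧ n ≤ L.lev (T^[k] w) := by
    intro k hk
    simp only [Finset.mem_insert, Finset.mem_singleton] at hk
    rcases hk with rfl | rfl | rfl | rfl
    · exact ⟨by omega, by simpa using (Nat.le_succ n).trans hw⟩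
    · exact ⟨by omega, by have := h2 3 (by omega) (by omega); omega⟩
    · exact ⟨by omega, by have := h2 2 (by omega) (by omega); omega⟩
    · exact ⟨by omega, by have := h2 1 (by omega) (by omega); omega⟩
  have hval : ∀ k ∈ ({0, r - 3, r - 2, r - 1} : Finset ℕ),
      (L.edge n (T^[k] w)).1 = (L.vtx (n + 1) w, k) := fun k hk =>
    edge_iterate_val hw (hS k hk).1 (hS k hk).2
  have hcard : ({0, r - 3, r - 2, r - 1} : Finset ℕ).card = 4 := by
    rw [Finset.card_insert_of_notMem, Finset.card_insert_of_notMem, Finset.card_insert_of_notMem,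
      Finset.card_singleton] <;> simp <;> omega
  rw [← hcard, ← Set.ncard_coe_finset, ← Set.InjOn.ncard_image (f := fun k => L.edge n (T^[k] w))]
  · refine Set.ncard_le_ncard ?_ (tgt_fiber_finite _ _)
    rintro _ ⟨k, hk, rfl⟩
    exact Subtype.ext (congrArg Prod.fst (hval k hk))
  · intro k hk k' hk' h
    have h' := congrArg Subtype.val h
    rw [hval k hk, hval k' hk'] at h'
    exact (Prod.mk.inj h').2

/-- The source of an edge is a tower over `{x | lev x = j}` if the range is, and `j > n + 1`. -/
theorem src_image_eq {n j : ℕ} (hj : n + 1 < j) :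
    L.src n '' {e | L.tgt n e ∈ L.vertClass (n + 1) j} = L.vertClass n j := by
  ext v
  constructor
  · rintro ⟨e, he, rfl⟩
    obtain ⟨w, k, hw, hk, hkl, rfl, ht⟩ := exists_edge_iterate e
    rw [mem_ofPred_eq, ht, toVert_mem_vertClass (by omega) hw] at he
    rw [src_edge]
    -- Starting above level `n + 1`, one step cannot fall below it, so the tower has height one and
    -- only one edge ends there.
    have hT : n + 1 ≤ L.lev (T w) := by
      have := L.lev_le w
      omega
    rw [L.ret_eq_one_iff.2 hT, Nat.lt_one_iff] at hk
    subst hk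
    exact ⟨w, by omega, he, rfl⟩
  · rintro ⟨x, hx, hxj, rfl⟩
    exact ⟨L.edge n x, ⟨x, by omega, hxj, rfl⟩, src_edge n x⟩

theorem src_mem_of_tgt_mem {n : ℕ} {e : L.Edge n}
    (he : L.tgt n e ∈ L.vertClass (n + 1) (n + 1)) :
    L.src n e ∈ L.vertClass n n ∪ L.vertClass n (n + 1) := by
  obtain ⟨w, k, hw, hk, hkl, rfl, ht⟩ := exists_edge_iterate e
  rw [ht, toVert_mem_vertClass (by omega) hw] at he
  rw [src_edge]
  rcases k.eq_zero_or_pos with rfl | hpos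
  · exact Or.inr ⟨w, by omega, he, rfl⟩
  · exact Or.inl ⟨_, hkl, lev_iterate_eq hpos hk hkl, rfl⟩

/-- A point of level `n` sits strictly above the base of its tower of level `n + 1`, so that tower
is tall. -/
theorem vertClass_subset_src (n : ℕ) :
    L.vertClass n n ⊆ L.src n '' {e | L.tgt n e ∈ L.tallClass (n + 1)} := by
  rintro _ ⟨x, -, hx, rfl⟩
  have hlt : L.lev x < n + 1 := by omega
  exact ⟨L.edge n x, ⟨L.base (n + 1) x, L.le_lev_base _ x, lev_map_base_lt hlt,
    toVert_eq_iff.2 (L.vtx_base _ x)⟩, src_edge n x⟩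

theorem src_image_diag (n : ℕ) :
    L.src n '' {e | L.tgt n e ∈ L.vertClass (n + 1) (n + 1)} =
      L.vertClass n n ∪ L.vertClass n (n + 1) := by
  refine Subset.antisymm ?_ (union_subset ?_ ?_)
  · rintro _ ⟨e, he, rfl⟩
    exact src_mem_of_tgt_mem he
  · exact (vertClass_subset_src n).trans (image_mono fun e he => tallClass_subset _ he)
  · rintro _ ⟨x, hx, hxj, rfl⟩
    exact ⟨L.edge n x, ⟨x, hxj.ge, hxj, rfl⟩, src_edge n x⟩

theorem src_mem_of_tgt_mem_flatClass {n : ℕ} {e : L.Edge n}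
    (he : L.tgt n e ∈ L.flatClass (n + 1)) : L.src n e ∈ L.vertClass n (n + 1) := by
  obtain ⟨w, k, hw, hk, hkl, rfl, ht⟩ := exists_edge_iterate e
  rw [ht, toVert_mem_flatClass (by omega) hw] at he
  rw [L.ret_eq_one_iff.2 he.2, Nat.lt_one_iff] at hk
  subst hk
  rw [src_edge]
  exact ⟨w, by omega, he.1, rfl⟩

theorem src_mem_of_isMin {n : ℕ} {e : L.Edge n} (he : L.tgt n e ∈ L.tallClass (n + 1))
    (hmin : IsMin e) : L.src n e ∈ L.vertClass n (n + 1) := by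
  obtain ⟨w, k, hw, hk, hkl, rfl, ht⟩ := exists_edge_iterate e
  rw [ht, toVert_mem_tallClass hw] at he
  rw [isMin_edge_iff, L.base_eq_self hkl] at hmin
  rcases k.eq_zero_or_pos with rfl | hpos
  · rw [src_edge]
    exact ⟨w, by omega, lev_eq_of_map_lt hw he, rfl⟩
  · have := lev_iterate_eq hpos hk hkl
    omega

theorem src_mem_of_not_isMin {n : ℕ} {e : L.Edge n} (hmin : ¬ IsMin e) :
    L.src n e ∈ L.vertClass n n := by
  obtain ⟨x, hx, rfl⟩ := exists_edge_eq e
  rw [isMin_edge_iff, L.base_eq_self hx] at hmin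
  rw [src_edge]
  exact ⟨x, hx, by omega, rfl⟩

/-- The maximal edge starts on the last floor, since that floor has level `n`. The next point has
level `n + 1`, so the source tower has height one. -/
theorem src_mem_of_isMax {n : ℕ} {e : L.Edge n} (he : L.tgt n e ∈ L.tallClass (n + 1))
    (hmax : IsMax e) : L.src n e ∈ L.flatClass n := by
  obtain ⟨w, k, hw, hk, hkl, rfl, ht⟩ := exists_edge_iterate e
  rw [ht, toVert_mem_tallClass hw] at he
  obtain ⟨h1, h2, h3⟩ := lev_last hw he
  have hlast := h2 1 le_rfl (by omega)
  have hk' : k = L.ret (n + 1) w - 1 := by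
    have hle : L.edge n (T^[k] w) ≤ L.edge n (T^[L.ret (n + 1) w - 1] w) := by
      rw [edge_le_iff, edge_iterate_val hw hk hkl, edge_iterate_val hw (by omega) (by omega)]
      exact ⟨rfl, by omega⟩
    have hge := (hmax hle).2
    rw [edge_iterate_val hw hk hkl, edge_iterate_val hw (by omega) (by omega)] at hge
    simp only at hge
    omega
  rw [src_edge]
  subst hk'
  exact ⟨_, by omega, by omega, rfl⟩

variable [Nonempty X]

theorem isSpecial_orderedDiagram : L.orderedDiagram.IsSpecial := by
  refine ⟨{
    VC := L.vertClass
    VC0 := L.tallClass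
    VC1 := L.flatClass
    EC := fun n j => {e | L.tgt n e ∈ L.vertClass (n + 1) j}
    EC0 := fun n => {e | L.tgt n e ∈ L.tallClass (n + 1)}
    EC1 := fun n => {e | L.tgt n e ∈ L.flatClass (n + 1)}
    VC_zero := fun j => ?_
    VC_cover := fun n hn v => ?_
    VC_disjoint := fun n hn j j' _ _ h => disjoint_vertClass hn h
    VC_finite := fun n _ j _ => vertClass_finite n j
    VC_two_le := fun n hn j hj => two_le_ncard_vertClass hn hj
    VC_diag := fun n _ => vertClass_self n
    VC_diag_disjoint := fun n _ => disjoint_tallClass_flatClass n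
    VC0_two_le := fun n hn => two_le_ncard_tallClass hn
    EC_cover := fun n e => ?_
    EC_disjoint := fun n j j' _ _ h =>
      (disjoint_vertClass (Nat.succ_pos n) h).preimage (L.tgt n)
    EC_finite := fun n j _ => ?_
    EC_source := fun n j hj => src_image_eq hj
    EC_range := fun n j hj e he => he
    EC_diag := fun n => ?_
    EC_diag_disjoint := fun n => (disjoint_tallClass_flatClass (n + 1)).preimage (L.tgt n)
    EC_diag_source := fun n => src_image_diag n
    EC0_source := fun n e he => src_mem_of_tgt_mem (tallClass_subset _ he)
    subset_EC0_source := fun n => vertClass_subset_src n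
    EC0_range := fun n e he => he
    EC1_source := fun n e he => src_mem_of_tgt_mem_flatClass he
    EC1_range := fun n e he => he
    card_range := fun n j hj v hv => ?_
    card_range_one := fun n v hv => ?_
    card_range_zero := fun n v hv => ?_
    source_min := fun n e he hmin => src_mem_of_isMin he hmin
    source_mid := fun n e he hmin _ => src_mem_of_not_isMin hmin
    source_max := fun n e he hmax => Or.inl (src_mem_of_isMax he hmax) }⟩
  -- At level `0` every class must be the full singleton, so each value `j` of `lev` has to be
  -- attained.
  · obtain ⟨x, hx⟩ := L.exists_lev_eq j
    refine Subset.antisymm (fun v _ => L.diagram.eq_v₀ v) ?_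
    rintro _ rfl
    exact ⟨x, Nat.zero_le _, hx, L.diagram.eq_v₀ _⟩
  · obtain ⟨x, hx, rfl⟩ := exists_toVert_eq v
    exact ⟨L.lev x, hx, x, hx, rfl, rfl⟩
  · obtain ⟨x, hx, h⟩ := exists_toVert_eq (L.tgt n e)
    exact ⟨L.lev x, hx, x, hx, rfl, h⟩
  · exact (vertClass_finite (n + 1) j).preimage' fun v _ => tgt_fiber_finite n v
  · exact congrArg (L.tgt n ⁻¹' ·) (vertClass_self (n + 1))
  · obtain ⟨w, hw, hwj, rfl⟩ := hv
    have := L.lev_le w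
    exact ncard_tgt_fiber_eq_one hw (by omega)
  · obtain ⟨w, hw, hw', rfl⟩ := hv
    exact ncard_tgt_fiber_eq_one hw.ge hw'
  · obtain ⟨w, hw, hw', rfl⟩ := hv
    exact four_le_ncard_tgt_fiber hw hw'

/-- A homeomorphism with a level function is conjugate to the Vershik transformation of a special
Borel–Bratteli diagram. -/
theorem exists_special_model [T1Space X] (L : LevelFunction T) :
    ∃ B : OrderedBorelBratteli, B.IsSpecial ∧
      ∃ F : X ≃ₜ B.PathSpace, ∀ x, F (T x) = B.vershik (F x) :=
  ⟨L.orderedDiagram, isSpecial_orderedDiagram,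
    (Equiv.ofBijective L.path ⟨path_injective, path_surjective⟩).toHomeomorphOfIsInducing
      isInducing_path, fun x => path_map x⟩

end LevelFunction

theorem Homeomorph.pow_apply_eq_iterate (T : X ≃ₜ X) (i : ℕ) (x : X) : (T ^ i) x = T^[i] x := by
  induction i with
  | zero => rfl
  | succ i ih =>
    rw [pow_succ', Function.iterate_succ_apply', ← ih]
    rfl

/-! ### Existence of level functions -/

/-- An exhaustion of the space adapted to `T`, containing given sets `K` and `U n`. -/
def compactExhaustion (T : X ≃ₜ X) (K : Set X) (U : ℕ → Set X) : ℕ → Set X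
  | 0 => ∅
  -- With the four images `i = 0, …, 3`, an orbit can exit only from a third image, after three
  -- consecutive points of the new layer. The preimage under `T` makes levels drop by at most one.
  | n + 1 => ⋃ i ∈ Finset.range 4, T^[i] ''
      (compactExhaustion T K U n ∪ T ⁻¹' compactExhaustion T K U n ∪ K ∪ U n)

namespace compactExhaustion

variable {T : X ≃ₜ X} {K : Set X} {U : ℕ → Set X}

theorem mem_succ {n : ℕ} {x : X} : x ∈ compactExhaustion T K U (n + 1) ↔ ∃ i < 4, ∃ y ∈
    compactExhaustion T K U n ∪ T ⁻¹' compactExhaustion T K U n ∪ K ∪ U n, T^[i] y = x := by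
  simp only [compactExhaustion, mem_iUnion, Finset.mem_range, exists_prop, mem_image]

theorem subset_succ (n : ℕ) :
    compactExhaustion T K U n ∪ T ⁻¹' compactExhaustion T K U n ∪ K ∪ U n ⊆
      compactExhaustion T K U (n + 1) :=
  fun x hx => mem_succ.2 ⟨0, by omega, x, hx, rfl⟩

theorem iterate_mem_succ {n i : ℕ} (hi : i < 4) {x : X} (hx : x ∈ compactExhaustion T K U n) :
    T^[i] x ∈ compactExhaustion T K U (n + 1) :=
  mem_succ.2 ⟨i, hi, x, Or.inl (Or.inl (Or.inl hx)), rfl⟩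

theorem monotone : Monotone (compactExhaustion T K U) :=
  monotone_nat_of_le_succ fun _ _ hx => iterate_mem_succ (i := 0) (by omega) hx

theorem isCompact_and_isOpen (hK : IsCompact K) (hK' : IsOpen K) (hU : ∀ n, IsCompact (U n))
    (hU' : ∀ n, IsOpen (U n)) (n : ℕ) :
    IsCompact (compactExhaustion T K U n) ∧ IsOpen (compactExhaustion T K U n) := by
  induction n with
  | zero => exact ⟨isCompact_empty, isOpen_empty⟩
  | succ n ih =>
    have h1 : IsCompact (T ⁻¹' compactExhaustion T K U n) := T.isCompact_preimage.2 ih.1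
    have h2 : IsOpen (T ⁻¹' compactExhaustion T K U n) := ih.2.preimage T.continuous
    refine ⟨(Finset.range 4).isCompact_biUnion fun i _ => ?_, isOpen_biUnion fun i _ => ?_⟩
    · exact (((ih.1.union h1).union hK).union (hU n)).image (T.continuous.iterate i)
    · rw [← funext (T.pow_apply_eq_iterate i)]
      exact (T ^ i).isOpenMap _ (((ih.2.union h2).union hK').union (hU' n))

/-- An exit point must be `T^[3] y` with `y` in the set whose images are taken, so the two preceding
points are images too. None of the three lies in the previous stage, whose first three forward
images stay in the present one. -/
theorem symm_iterate_mem_of_exit {n : ℕ} {x : X} (hx : x ∈ compactExhaustion T K U (n + 1))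
    (hTx : T x ∉ compactExhaustion T K U (n + 1)) {i : ℕ} (hi : i < 3) :
    T.symm^[i] x ∈ compactExhaustion T K U (n + 1) \ compactExhaustion T K U n := by
  obtain ⟨j, hj, y, hy, rfl⟩ := mem_succ.1 hx
  obtain rfl : j = 3 := by
    by_contra hne
    exact hTx (mem_succ.2 ⟨j + 1, by omega, y, hy, Function.iterate_succ_apply' T j y⟩)
  constructor
  · rw [T.symm_iterate_iterate hi.le]
    exact mem_succ.2 ⟨3 - i, by omega, y, hy, rfl⟩
  · intro h
    have := iterate_mem_succ (i := i + 1) (by omega) h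
    rw [Function.iterate_succ_apply', T.iterate_symm_iterate le_rfl, Nat.sub_self] at this
    exact hTx this

end compactExhaustion

/-- If every orbit leaves the infinite set `C` in both directions of time, then `C` has infinitely
many entrance points. -/
theorem infinite_setOf_map_mem {T : X ≃ₜ X} {C : Set X} (hC : C.Infinite)
    (hf : ∀ x, ∃ i, 0 < i ∧ T^[i] x ∉ C) (hb : ∀ x, ∃ i, T.symm^[i] x ∉ C) :
    {x | x ∉ C ∧ T x ∈ C}.Infinite := by
  classical
  intro hfin
  choose h hpos hout using hf
  -- Each point of `C` is reached from an entrance point `w` without leaving `C`, hence in fewer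
  -- than `h w` steps. Finitely many entrances would make `C` finite.
  refine hC ((hfin.biUnion fun w _ => (Set.finite_Iio (h w)).image fun i => T^[i] w).subset ?_)
  intro x hx
  set i := Nat.find (hb x) with hi
  have hmin : ∀ m < i, T.symm^[m] x ∈ C := fun m hm => not_not.1 (Nat.find_min (hb x) hm)
  have hspec : T.symm^[i] x ∉ C := Nat.find_spec (hb x)
  have hi0 : 0 < i := by
    rw [Nat.pos_iff_ne_zero]
    intro h0
    rw [h0] at hspec
    exact hspec hx
  refine mem_biUnion (x := T.symm^[i] x) ⟨hspec, ?_⟩ ⟨i, ?_, ?_⟩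
  · have := T.iterate_symm_iterate (m := 1) hi0 x
    rw [Function.iterate_one] at this
    rw [this]
    exact hmin _ (by omega)
  · rw [mem_Iio]
    by_contra! hle
    refine hout (T.symm^[i] x) ?_
    rw [T.iterate_symm_iterate hle]
    exact hmin _ (by have := hpos (T.symm^[i] x); omega)
  · simp [T.iterate_symm_iterate le_rfl]

theorem nonempty_levelFunction [T2Space X] {T : X ≃ₜ X}
    (hf : ∀ C : Set X, IsCompact C → ∀ x, ∃ i, 0 < i ∧ T^[i] x ∉ C)
    (hb : ∀ C : Set X, IsCompact C → ∀ x, ∃ i, T.symm^[i] x ∉ C)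
    {K : Set X} (hK : IsCompact K) (hK' : IsOpen K) (hKinf : K.Infinite)
    {U : ℕ → Set X} (hU : ∀ n, IsCompact (U n)) (hU' : ∀ n, IsOpen (U n))
    (hbasis : ∀ x O, IsOpen O → x ∈ O → ∃ i, x ∈ U i ∧ U i ⊆ O) :
    Nonempty (LevelFunction T) := by
  classical
  set C := compactExhaustion T K U with hCdef
  have hC : ∀ n, IsCompact (C n) ∧ IsOpen (C n) :=
    compactExhaustion.isCompact_and_isOpen hK hK' hU hU'
  have hmono : Monotone C := compactExhaustion.monotone
  have hex : ∀ x, ∃ n, x ∈ C (n + 1) := fun x => by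
    obtain ⟨i, hi, -⟩ := hbasis x univ isOpen_univ (mem_univ x)
    exact ⟨i, compactExhaustion.subset_succ i (Or.inr hi)⟩
  let lev : X → ℕ := fun x => Nat.find (hex x)
  have hlev : ∀ {n x}, x ∈ C n ↔ lev x < n := by
    intro n x
    constructor
    · intro hx
      rcases n with - | n
      · exact hx.elim
      · exact Nat.lt_succ_of_le (Nat.find_min' (hex x) hx)
    · exact fun hx => hmono (Nat.succ_le_of_lt hx) (Nat.find_spec (hex x))
  have hlev' : ∀ {n x}, x ∈ C (n + 1) \ C n ↔ lev x = n := by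
    intro n x
    rw [mem_sdiff, hlev, hlev]
    omega
  have hloc : IsLocallyConstant lev := by
    rw [IsLocallyConstant.iff_eventually_eq]
    intro x
    filter_upwards [((hC (lev x + 1)).2.sdiff (hC (lev x)).1.isClosed).mem_nhds (hlev'.2 rfl)]
      with y hy
    exact hlev'.1 hy
  have hle : ∀ x, lev x ≤ lev (T x) + 1 := by
    intro x
    have h : x ∈ C (lev (T x) + 1 + 1) := compactExhaustion.subset_succ _
      (Or.inl (Or.inl (Or.inr (hlev.2 (Nat.lt_succ_self _)))))
    rw [hlev] at h
    omega
  have hsplit : ∀ n, ∃ O, IsClopen O ∧ (1 ≤ n → ∃ x y, n ≤ lev x ∧ lev (T x) < n ∧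
      n ≤ lev y ∧ lev (T y) < n ∧ x ∈ O ∧ y ∉ O) := by
    rintro (- | n)
    · exact ⟨∅, isClopen_empty, by omega⟩
    have hinf : (C (n + 1)).Infinite :=
      hKinf.mono fun x hx => compactExhaustion.subset_succ n (Or.inl (Or.inr hx))
    obtain ⟨x, hx, y, hy, hne⟩ := (infinite_setOf_map_mem hinf (hf _ (hC _).1)
      (hb _ (hC _).1)).nontrivial
    obtain ⟨i, hi, hi'⟩ := hbasis x {y}ᶜ isOpen_compl_singleton hne
    refine ⟨U i, ⟨(hU i).isClosed, hU' i⟩, fun _ => ⟨x, y, ?_, hlev.1 hx.2, ?_, hlev.1 hy.2, hi,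
      fun h => hi' h rfl⟩⟩
    · exact not_lt.1 fun h => hx.1 (hlev.2 h)
    · exact not_lt.1 fun h => hy.1 (hlev.2 h)
  choose O hO hO' using hsplit
  -- The separating sets of all levels are glued along the clopen layers of `lev`. Entrance points
  -- into `C n` have level exactly `n`, so the glued set separates them as `O n` does.
  have hW : IsClopen {x | x ∈ O (lev x)} := by
    have hev := (IsLocallyConstant.iff_eventually_eq _).1 hloc
    refine ⟨⟨isOpen_iff_mem_nhds.2 fun x hx => ?_⟩, isOpen_iff_mem_nhds.2 fun x hx => ?_⟩
    · filter_upwards [hev x, (hO (lev x)).compl.isOpen.mem_nhds hx] with y hy hy'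
      change y ∉ O (lev y)
      rwa [hy]
    · filter_upwards [hev x, (hO (lev x)).isOpen.mem_nhds hx] with y hy hy'
      rwa [hy]
  exact ⟨{
    lev := lev
    U := fun i => Nat.casesOn i {x | x ∈ O (lev x)} U
    isLocallyConstant_lev := hloc
    isCompact_lev := fun n => by
      convert! (hC n).1 using 1
      ext x
      exact hlev.symm
    lev_le := hle
    lev_eq_of_lt := fun x hx => by
      have h1 : x ∈ C (lev x + 1) := hlev.2 (Nat.lt_succ_self _)
      have h2 : T x ∉ C (lev x + 1) := fun h => by
        rw [hlev] at h
        omega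
      have h3 := compactExhaustion.symm_iterate_mem_of_exit h1 h2 (i := 1) (by omega)
      have h4 := compactExhaustion.symm_iterate_mem_of_exit h1 h2 (i := 2) (by omega)
      have h5 : T x ∈ C (lev x + 1 + 1) :=
        compactExhaustion.iterate_mem_succ (i := 1) (by omega) h1
      rw [hlev] at h5
      exact ⟨by omega, hlev'.1 h3, hlev'.1 h4⟩
    forward := fun n x => by
      obtain ⟨i, hi, h⟩ := hf _ (hC n).1 x
      exact ⟨i, hi, not_lt.1 fun h' => h (hlev.2 h')⟩
    backward := fun n x => by
      obtain ⟨i, h⟩ := hb _ (hC n).1 x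
      exact ⟨i, not_lt.1 fun h' => h (hlev.2 h')⟩
    isClopen_U := fun i => by
      rcases i with - | i
      · exact hW
      · exact ⟨(hU i).isClosed, hU' i⟩
    exists_split := fun n hn => by
      obtain ⟨x, y, h1, h2, h3, h4, h5, h6⟩ := hO' n hn
      have hx : lev x = n := by have := hle x; omega
      have hy : lev y = n := by have := hle y; omega
      refine ⟨x, y, h1, h2, h3, h4, ?_, ?_⟩
      · rw [← hx] at h5
        exact h5
      · rw [← hy] at h6
        exact h6
    exists_subset := fun x O hO hx => by
      obtain ⟨i, hi⟩ := hbasis x O hO hx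
      exact ⟨i + 1, hi⟩ }⟩

/-! ### Markers -/

namespace IsVanishingMarkers

variable [MeasurableSpace X] {T : X ≃ₜ X} {A : ℕ → Set X}

theorem exists_forward (hA : IsVanishingMarkers T A) {n : ℕ} (hn : 1 ≤ n) (x : X) :
    ∃ i, 0 < i ∧ T^[i] x ∈ A n := by
  obtain ⟨k, hk⟩ := hA.section_self n hn x
  obtain ⟨m, hm, hlt⟩ := (hA.recurrent_pos n hn _ hk).exists_gt k.natAbs
  refine ⟨(m + k).toNat, by omega, ?_⟩
  have hz : ((m + k).toNat : ℤ) = m + k := Int.toNat_of_nonneg (by omega)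
  rw [← T.pow_apply_eq_iterate, ← zpow_natCast, hz, zpow_add, zpow_natCast]
  exact hm

theorem exists_backward (hA : IsVanishingMarkers T A) {n : ℕ} (hn : 1 ≤ n) (x : X) :
    ∃ i, 0 < i ∧ T.symm^[i] x ∈ A n := by
  obtain ⟨k, hk⟩ := hA.section_self n hn x
  obtain ⟨m, hm, hlt⟩ := (hA.recurrent_neg n hn _ hk).exists_gt k.natAbs
  refine ⟨(m - k).toNat, by omega, ?_⟩
  have hz : ((m - k).toNat : ℤ) = m - k := Int.toNat_of_nonneg (by omega)
  rw [← T.symm.pow_apply_eq_iterate, ← zpow_natCast, hz]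
  have : T.symm ^ ((m : ℤ) - k) = T⁻¹ ^ m * T ^ k := by
    change T⁻¹ ^ ((m : ℤ) - k) = _
    rw [zpow_sub, zpow_natCast, inv_zpow, inv_inv]
  rw [this]
  exact hm

/-- A point outside `A n` lies between its last and next visits to `A n`, thus on a tower floor of
positive index. Such floors are open and disjoint from `A n`. -/
theorem isClosed (hA : IsVanishingMarkers T A) (hclopen : HasClopenTowers T A) {n : ℕ}
    (hn : 1 ≤ n) : IsClosed (A n) := by
  classical
  rw [← isOpen_compl_iff, isOpen_iff_mem_nhds]
  intro x hx
  have hf := hA.exists_forward hn x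
  have hb := hA.exists_backward hn x
  set j := Nat.find hf with hj
  set i := Nat.find hb with hi
  obtain ⟨hj0, hjA⟩ : 0 < j ∧ T^[j] x ∈ A n := Nat.find_spec hf
  obtain ⟨hi0, hiA⟩ : 0 < i ∧ T.symm^[i] x ∈ A n := Nat.find_spec hb
  have hjmin : ∀ m, 0 < m → m < j → T^[m] x ∉ A n := fun m h1 h2 h3 =>
    Nat.find_min hf h2 ⟨h1, h3⟩
  have himin : ∀ m, 0 < m → m < i → T.symm^[m] x ∉ A n := fun m h1 h2 h3 =>
    Nat.find_min hb h2 ⟨h1, h3⟩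
  have hxi : T^[i] (T.symm^[i] x) = x := by simp [T.iterate_symm_iterate le_rfl]
  have hmem : x ∈ (T ^ i) '' towerBase T (A n) (j + i) := by
    refine ⟨T.symm^[i] x, ⟨hiA, ?_, fun m h1 h2 => ?_⟩, ?_⟩
    · rwa [T.pow_apply_eq_iterate, Function.iterate_add_apply, hxi]
    · rw [T.pow_apply_eq_iterate]
      rcases lt_trichotomy m i with h | rfl | h
      · rw [T.iterate_symm_iterate h.le]
        exact himin _ (by omega) (by omega)
      · rwa [hxi]
      · rw [← Nat.sub_add_cancel h.le, Function.iterate_add_apply, hxi]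
        exact hjmin _ (by omega) (by omega)
    · rw [T.pow_apply_eq_iterate, hxi]
  refine Filter.mem_of_superset ((hclopen n hn (j + i) i (by omega)).isOpen.mem_nhds hmem) ?_
  rintro _ ⟨w, hw, rfl⟩
  exact hw.2.2 i hi0 (by omega)

/-- Compactness, applied to the decreasing closed sets `A (n + 1)` with empty intersection. -/
theorem exists_disjoint (hA : IsVanishingMarkers T A) (hclopen : HasClopenTowers T A)
    {C : Set X} (hC : IsCompact C) : ∃ n, 1 ≤ n ∧ Disjoint C (A n) := by
  obtain ⟨n, hn⟩ := hC.elim_directed_family_closed (fun n => A (n + 1))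
    (fun n => hA.isClosed hclopen (Nat.succ_pos n)) (by
      rw [← subset_empty_iff, ← hA.inter]
      rintro x ⟨-, hx⟩
      rw [mem_iInter] at hx ⊢
      exact fun n => hA.antitone n (hx n))
    (antitone_nat_of_succ_le fun n => hA.antitone (n + 1)).directed_ge
  exact ⟨n + 1, Nat.succ_pos n, Set.disjoint_iff_inter_eq_empty.2 hn⟩

theorem not_countable [Nonempty X] (hA : IsVanishingMarkers T A) : ¬ Countable X := by
  classical
  intro _
  obtain ⟨k, hk⟩ := hA.section_self 1 le_rfl (Classical.arbitrary X)
  set y := (T ^ k) (Classical.arbitrary X)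
  have hf := hA.exists_forward le_rfl y
  obtain ⟨h1, h2⟩ := Nat.find_spec hf
  refine hA.uncountable 1 le_rfl _ h1 ⟨y, hk, ?_, fun i hi hi' h => ?_⟩ (Set.to_countable _)
  · rwa [T.pow_apply_eq_iterate]
  · rw [T.pow_apply_eq_iterate] at h
    exact Nat.find_min hf hi' ⟨hi, h⟩

end IsVanishingMarkers

/-- A locally compact zero-dimensional second countable Hausdorff space has a countable base of
compact open sets. -/
theorem exists_compactOpen_basis [T2Space X] [SecondCountableTopology X] [LocallyCompactSpace X]
    (hX : TopologicalSpace.IsTopologicalBasis {U : Set X | IsClopen U}) :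
    ∃ U : ℕ → Set X, (∀ n, IsCompact (U n)) ∧ (∀ n, IsOpen (U n)) ∧
      ∀ x O, IsOpen O → x ∈ O → ∃ i, x ∈ U i ∧ U i ⊆ O := by
  have hb : TopologicalSpace.IsTopologicalBasis {U : Set X | IsCompact U ∧ IsOpen U} := by
    refine TopologicalSpace.isTopologicalBasis_of_isOpen_of_nhds (fun U hU => hU.2) ?_
    intro x O hx hO
    obtain ⟨K, hK, hKO, hKc⟩ := local_compact_nhds (hO.mem_nhds hx)
    obtain ⟨V, hV, hxV, hVK⟩ := hX.mem_nhds_iff.1 hK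
    exact ⟨V, ⟨hKc.of_isClosed_subset hV.isClosed hVK, hV.isOpen⟩, hxV, hVK.trans hKO⟩
  obtain ⟨s, hs, hsc, hsb⟩ := hb.exists_countable
  obtain ⟨U, hU⟩ := (hsc.insert ∅).exists_eq_range (insert_nonempty _ _)
  have hmem : ∀ n, IsCompact (U n) ∧ IsOpen (U n) := fun n => by
    rcases (hU ▸ mem_range_self n : U n ∈ insert ∅ s) with h | h
    · rw [h]
      exact ⟨isCompact_empty, isOpen_empty⟩
    · exact hs h
  refine ⟨U, fun n => (hmem n).1, fun n => (hmem n).2, fun x O hO hx => ?_⟩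
  obtain ⟨V, hV, hxV, hVO⟩ := hsb.mem_nhds_iff.1 (hO.mem_nhds hx)
  obtain ⟨i, rfl⟩ : V ∈ range U := hU ▸ mem_insert_of_mem _ hV
  exact ⟨i, hxV, hVO⟩

end LevelFunctions

theorem theorem4p4 {X : Type*} [TopologicalSpace X] [PolishSpace X] [LocallyCompactSpace X]
    [MeasurableSpace X] [BorelSpace X] [Nonempty X]
    (hX : TopologicalSpace.IsTopologicalBasis {U : Set X | IsClopen U})
    (T : X ≃ₜ X) (hT : IsAperiodic T)
    (A : ℕ → Set X) (hA : IsVanishingMarkers T A) (hclopen : HasClopenTowers T A) :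
    ∃ B : OrderedBorelBratteli, B.IsSpecial ∧
      ∃ F : X ≃ₜ B.PathSpace, ∀ x, F (T x) = B.vershik (F x) := by
  obtain ⟨U, hU, hU', hbasis⟩ := exists_compactOpen_basis hX
  -- If all basic sets were finite, `X` would be countable, whereas a non-empty tower base over `A
  -- 1` is uncountable. The infinite one serves as `K`.
  obtain ⟨m, hm⟩ : ∃ m, (U m).Infinite := by
    by_contra! h
    refine hA.not_countable (countable_univ_iff.1 ((countable_iUnion fun m =>
      (h m).countable).mono fun x _ => ?_))
    obtain ⟨i, hi, -⟩ := hbasis x univ isOpen_univ (mem_univ x)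
    exact mem_iUnion.2 ⟨i, hi⟩
  obtain ⟨L⟩ := nonempty_levelFunction (T := T)
    (fun C hC x => by
      obtain ⟨n, hn, hd⟩ := hA.exists_disjoint hclopen hC
      obtain ⟨i, hi, hx⟩ := hA.exists_forward hn x
      exact ⟨i, hi, Set.disjoint_right.1 hd hx⟩)
    (fun C hC x => by
      obtain ⟨n, hn, hd⟩ := hA.exists_disjoint hclopen hC
      obtain ⟨i, hi, hx⟩ := hA.exists_backward hn x
      exact ⟨i, Set.disjoint_right.1 hd hx⟩)
    (hU m) (hU' m) hm hU hU' hbasis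
  exact L.exists_special_model
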